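/- **Notation.** Let $\mathcal A_2$ be the group of order 6 acting on $\{k\in\mathbb R^3: k_1+k_2+k_3=0\}$ generated by the reflections $k\mapsto-(k_1,k_3,k_2)$, $-(k_2,k_1,k_3)$, $-(k_3,k_2,k_1)$, and let $(-1)^{|\sigma|}$ be $-1$ for these three reflections and $1$ for the other three elements. With $\phi_k(t)=e^{\frac{2\pi i}{3}k\cdot t}$ put $$\mathsf{CC}_k=\tfrac1{12}\sum_{\sigma\in\mathcal A_2}(\phi_{k\sigma}+\phi_{-k\sigma}),\qquad \mathsf{SC}_k=\tfrac1{12i}\sum_{\sigma\in\mathcal A_2}(\phi_{k\sigma}-\phi_{-k\sigma}),$$ $$\mathsf{CS}_k=\tfrac1{12i}\sum_{\sigma\in\mathcal A_2}(-1)^{|\sigma|}(\phi_{k\sigma}-\phi_{-k\sigma}),\qquad \mathsf{SS}_k=-\tfrac1{12}\sum_{\sigma\in\mathcal A_2}(-1)^{|\sigma|}(\phi_{k\sigma}+\phi_{-k\sigma}).$$ Let $\triangle=\{t\in\mathbb R^3: t_1+t_2+t_3=0,\ 0\le t_2\le t_1\le -t_3\le 1\}$, let $x(t)=\mathsf{CC}_{1,0,-1}(t)$,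 $y(t)=\mathsf{CC}_{1,1,-2}(t)$ (these are real), and let $\triangle^*\subset\mathbb R^2$ be the image of $\triangle$ under $t\mapsto(x(t),y(t))$. For $k_1,k_2\in\mathbb N_0$ the generalized Chebyshev polynomials are the real polynomials $Q^{\alpha,\beta}_{k_1,k_2}(x,y)$, $\alpha,\beta\in\{-\frac12,\frac12\}$, which under $x=x(t)$, $y=y(t)$, $t\in\triangle$, satisfy $$Q^{-\frac12,-\frac12}_{k_1,k_2}=\mathsf{CC}_{k_1+k_2,\,k_2,\,-k_1-2k_2},\qquad Q^{\frac12,-\frac12}_{k_1,k_2}=\frac{\mathsf{SC}_{k_1+k_2+1,\,k_2,\,-k_1-2k_2-1}}{\mathsf{SC}_{1,0,-1}},$$ $$Q^{-\frac12,\frac12}_{k_1,k_2}=\frac{\mathsf{CS}_{k_1+k_2+1,\,k_2+1,\,-k_1-2k_2-2}}{\mathsf{CS}_{1,1,-2}},\qquad Q^{\frac12,\frac12}_{k_1,k_2}=\frac{\mathsf{SS}_{k_1+k_2+2,\,k_2+1,\,-k_1-2k_2-3}}{\mathsf{SS}_{2,1,-3}}$$ wherever the denominator does not vanish. Let $$w_{\alpha,\beta}=\frac{(4\pi^2)^{\alpha+\beta}}{3^{2\alpha+\beta}}(1+2y-3x^2)^\alpha(24x^3-y^2-12xy-6x-4y-1)^\beta,$$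 $$\langle f,g\rangle_{w_{\alpha,\beta}}=c_{\alpha,\beta}\int_{\triangle^*}fg\,w_{\alpha,\beta}\,dx\,dy,\qquad c_{\alpha,\beta}=1\Big/\int_{\triangle^*}w_{\alpha,\beta}\,dx\,dy.$$ In the interior of $\triangle^*$ let $\mathcal L_{\alpha,\beta}=-w_{-\alpha,-\beta}\nabla^{\mathsf{tr}}w_{\alpha,\beta}\Lambda\nabla$, where $\Lambda=\begin{pmatrix}A_{11}&A_{12}\\A_{12}&A_{22}\end{pmatrix}$ with $A_{11}=-6x^2+y+3x+2$, $A_{12}=-9xy+18x^2-6y-3$, $A_{22}=-18y^2+108x^3-54xy-27x-9y$; explicitly, on polynomials, $$\mathcal L_{\alpha,\beta}=-A_{11}\partial_x^2-2A_{12}\partial_x\partial_y-A_{22}\partial_y^2+B_1\partial_x+B_2\partial_y,$$ $$B_1=(21+12\alpha+18\beta)x+6\alpha+3,\qquad B_2=(18+36\alpha)x+(45+36\beta+18\alpha)y+18\beta+9.$$ Put $|k|_*=2k_1+3k_2$, and let $\Pi_n^*$ be the span of the monomials $x^{j_1}y^{j_2}$ with $|j|_*\le n$. Write $j\prec k$ if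 $|j|_*<|k|_*$ or $2(j_1-k_1)=3(k_2-j_2)>0$, and let $\Pi^*_{k_1,k_2}$ be the span of the $x^{j_1}y^{j_2}$ with $j\prec k$ or $j=k$. Finally put $$\lambda^{\alpha,\beta}_{k_1,k_2}=\tfrac32|k|_*(|k|_*+5+4\alpha+6\beta)+\tfrac92k_2(k_2+1+2\beta).$$ The generalized Jacobi polynomials for $(\alpha,\beta)$ are the system $(P^{\alpha,\beta}_{k_1,k_2})_{k_1,k_2\ge0}$ of real polynomials such that $P^{\alpha,\beta}_{k_1,k_2}\in\Pi^*_{k_1,k_2}$, the coefficient of $x^{k_1}y^{k_2}$ in $P^{\alpha,\beta}_{k_1,k_2}$ is $1$, $\mathcal L_{\alpha,\beta}P^{\alpha,\beta}_{k_1,k_2}=\lambda^{\alpha,\beta}_{k_1,k_2}P^{\alpha,\beta}_{k_1,k_2}$, all products $P^{\alpha,\beta}_{k}P^{\alpha,\beta}_{j}w_{\alpha,\beta}$ are integrable on $\triangle^*$, and $\langle P^{\alpha,\beta}_{k},P^{\alpha,\beta}_{j}\rangle_{w_{\alpha,\beta}}=0$ for $k\ne j$. **Corollary 5.7.** Let $\alpha,\beta\in\{-\frac12,\frac12\}$.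 The system of generalized Jacobi polynomials for $(\alpha,\beta)$ exists and is unique. For all $k_1,k_2\ge0$ the generalized Chebyshev polynomial $Q=Q^{\alpha,\beta}_{k_1,k_2}$ exists, is unique, and satisfies $$\mathcal L_{\alpha,\beta}Q=\lambda^{\alpha,\beta}_{k_1,k_2}Q,$$ as an identity of polynomials for the explicit form of $\mathcal L_{\alpha,\beta}$, and at every point of the interior of $\triangle^*$ for its divergence form. Moreover $Q\in\Pi^*_{|k|_*}$, and there is a constant $c\neq0$ with $Q=c\,P^{\alpha,\beta}_{k_1,k_2}$. -/

import Mathlib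

namespace G2Cheb

open MeasureTheory

noncomputable section

/-- The exponential `φ_k(t) = exp((2πi/3) k·t)` in homogeneous coordinates. -/
def phi (k : Fin 3 → ℤ) (t : Fin 3 → ℝ) : ℂ :=
  Complex.exp (2 * Real.pi * Complex.I / 3 * ∑ i, (k i : ℂ) * (t i : ℂ))

/-- The sum `∑_{σ ∈ A₂} ε^{|σ|} g(kσ)`. The group `A₂` consists of the identity, the two
cyclic rotations (these have `|σ|` even), and the reflections `k ↦ -(k₁,k₃,k₂)`,
`k ↦ -(k₂,k₁,k₃)`, `k ↦ -(k₃,k₂,k₁)` (these have `|σ|` odd). -/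
def sumA2 (ε : ℂ) (g : (Fin 3 → ℤ) → ℂ) (k : Fin 3 → ℤ) : ℂ :=
  g k + g ![k 1, k 2, k 0] + g ![k 2, k 0, k 1]
    + ε * (g ![-k 0, -k 2, -k 1] + g ![-k 1, -k 0, -k 2] + g ![-k 2, -k 1, -k 0])

/-- The generalized trigonometric function `CC_k`. -/
def CC (k : Fin 3 → ℤ) (t : Fin 3 → ℝ) : ℂ :=
  1 / 12 * sumA2 1 (fun j => phi j t + phi (-j) t) k

/-- The generalized trigonometric function `SC_k`. -/
def SC (k : Fin 3 → ℤ) (t : Fin 3 → ℝ) : ℂ :=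
  1 / (12 * Complex.I) * sumA2 1 (fun j => phi j t - phi (-j) t) k

/-- The generalized trigonometric function `CS_k`. -/
def CS (k : Fin 3 → ℤ) (t : Fin 3 → ℝ) : ℂ :=
  1 / (12 * Complex.I) * sumA2 (-1) (fun j => phi j t - phi (-j) t) k

/-- The generalized trigonometric function `SS_k`. -/
def SS (k : Fin 3 → ℤ) (t : Fin 3 → ℝ) : ℂ :=
  -(1 / 12) * sumA2 (-1) (fun j => phi j t + phi (-j) t) k

/-- The fundamental triangle `0 ≤ t₂ ≤ t₁ ≤ -t₃ ≤ 1` in the plane `t₁ + t₂ + t₃ = 0`. -/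
def triangle : Set (Fin 3 → ℝ) :=
  {t | t 0 + t 1 + t 2 = 0 ∧ 0 ≤ t 1 ∧ t 1 ≤ t 0 ∧ t 0 ≤ -t 2 ∧ -t 2 ≤ 1}

/-- The new variable `x = CC_{1,0,-1}(t)`. The values of `CC` are real (see `CC_im`). -/
def xCoord (t : Fin 3 → ℝ) : ℝ := (CC ![1, 0, -1] t).re

/-- The new variable `y = CC_{1,1,-2}(t)`. -/
def yCoord (t : Fin 3 → ℝ) : ℝ := (CC ![1, 1, -2] t).re

theorem phi_add_phi_neg_im (k : Fin 3 → ℤ) (t : Fin 3 → ℝ) :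
    (phi k t + phi (-k) t).im = 0 := by
  have h : ∀ k : Fin 3 → ℤ, phi k t =
      Complex.exp (((2 * Real.pi / 3 * ∑ i, (k i : ℝ) * t i : ℝ) : ℂ) * Complex.I) := by
    intro k
    unfold phi
    congr 1
    push_cast
    ring
  rw [h, h, Complex.add_im, Complex.exp_ofReal_mul_I_im, Complex.exp_ofReal_mul_I_im]
  simp [Finset.sum_neg_distrib]

theorem CC_im (k : Fin 3 → ℤ) (t : Fin 3 → ℝ) : (CC k t).im = 0 := by
  have key : ∀ g : (Fin 3 → ℤ) → ℂ, (∀ j, (g j).im = 0) →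
      (1 / 12 * sumA2 1 g k).im = 0 := by
    intro g h
    have e : (1 / 12 : ℂ) = ((1 / 12 : ℝ) : ℂ) := by push_cast; rfl
    rw [e, Complex.im_ofReal_mul]
    simp [sumA2, h]
  exact key _ fun j => phi_add_phi_neg_im j t

/-- The region `△*`, the image of the triangle under the change of variables. -/
def deltaStar : Set (ℝ × ℝ) := (fun t => (xCoord t, yCoord t)) '' triangle

/-- The value of a polynomial in the two variables `x = X 0`, `y = X 1` at a point. -/
def evalAt (P : MvPolynomial (Fin 2) ℝ) (p : ℝ × ℝ) : ℝ := MvPolynomial.eval ![p.1, p.2] P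

/-- For `α, β = ±1/2`: `Q` is the generalized Chebyshev polynomial with index `(k₁,k₂)`,
that is, under the change of variables it is the prescribed generalized trigonometric
function, or quotient of two such functions wherever the denominator does not vanish. -/
def IsChebyshev (α β : ℝ) (k₁ k₂ : ℕ) (Q : MvPolynomial (Fin 2) ℝ) : Prop :=
  ∀ t ∈ triangle,
    (α = -1 / 2 → β = -1 / 2 →
      (evalAt Q (xCoord t, yCoord t) : ℂ) = CC ![k₁ + k₂, k₂, -k₁ - 2 * k₂] t) ∧
    (α = 1 / 2 → β = -1 / 2 → SC ![1, 0, -1] t ≠ 0 →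
      (evalAt Q (xCoord t, yCoord t) : ℂ) =
        SC ![k₁ + k₂ + 1, k₂, -k₁ - 2 * k₂ - 1] t / SC ![1, 0, -1] t) ∧
    (α = -1 / 2 → β = 1 / 2 → CS ![1, 1, -2] t ≠ 0 →
      (evalAt Q (xCoord t, yCoord t) : ℂ) =
        CS ![k₁ + k₂ + 1, k₂ + 1, -k₁ - 2 * k₂ - 2] t / CS ![1, 1, -2] t) ∧
    (α = 1 / 2 → β = 1 / 2 → SS ![2, 1, -3] t ≠ 0 →
      (evalAt Q (xCoord t, yCoord t) : ℂ) =
        SS ![k₁ + k₂ + 2, k₂ + 1, -k₁ - 2 * k₂ - 3] t / SS ![2, 1, -3] t)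

/-- The weight function `w_{α,β}`. Both bases are nonnegative on `△*` and positive in its
interior. -/
def weight (α β : ℝ) (p : ℝ × ℝ) : ℝ :=
  (4 * Real.pi ^ 2) ^ (α + β) / (3 : ℝ) ^ (2 * α + β)
    * (1 + 2 * p.2 - 3 * p.1 ^ 2) ^ α
    * (24 * p.1 ^ 3 - p.2 ^ 2 - 12 * p.1 * p.2 - 6 * p.1 - 4 * p.2 - 1) ^ β

/-- The normalization constant `c_{α,β} = 1 / ∫_{△*} w_{α,β}`. -/
def normConst (α β : ℝ) : ℝ := 1 / ∫ p in deltaStar, weight α β p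

/-- The inner product `⟨P, Q⟩_{w_{α,β}}` of real polynomials. -/
def innerW (α β : ℝ) (P Q : MvPolynomial (Fin 2) ℝ) : ℝ :=
  normConst α β * ∫ p in deltaStar, evalAt P p * evalAt Q p * weight α β p

open MvPolynomial in
/-- The coefficient `A₁₁ = -6x² + y + 3x + 2`. -/
def A₁₁ : MvPolynomial (Fin 2) ℝ := -6 * X 0 ^ 2 + X 1 + 3 * X 0 + 2

open MvPolynomial in
/-- The coefficient `A₁₂ = A₂₁ = -9xy + 18x² - 6y - 3`. -/
def A₁₂ : MvPolynomial (Fin 2) ℝ := -9 * X 0 * X 1 + 18 * X 0 ^ 2 - 6 * X 1 - 3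

open MvPolynomial in
/-- The coefficient `A₂₂ = -18y² + 108x³ - 54xy - 27x - 9y`. -/
def A₂₂ : MvPolynomial (Fin 2) ℝ :=
  -18 * X 1 ^ 2 + 108 * X 0 ^ 3 - 54 * X 0 * X 1 - 27 * X 0 - 9 * X 1

/-- Partial derivative in `x` of a function on the plane. -/
def partialX (u : ℝ × ℝ → ℝ) (p : ℝ × ℝ) : ℝ := deriv (fun s => u (s, p.2)) p.1

/-- Partial derivative in `y` of a function on the plane. -/
def partialY (u : ℝ × ℝ → ℝ) (p : ℝ × ℝ) : ℝ := deriv (fun s => u (p.1, s)) p.2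

/-- The differential operator `L_{α,β} = -w_{-α,-β} ∇ᵗʳ w_{α,β} Λ ∇` in divergence form,
to be used in the interior of `△*`. -/
def opDiv (α β : ℝ) (u : ℝ × ℝ → ℝ) (p : ℝ × ℝ) : ℝ :=
  -weight (-α) (-β) p *
    (partialX (fun q => weight α β q *
        (evalAt A₁₁ q * partialX u q + evalAt A₁₂ q * partialY u q)) p
      + partialY (fun q => weight α β q *
        (evalAt A₁₂ q * partialX u q + evalAt A₂₂ q * partialY u q)) p)

open MvPolynomial in
/-- The same operator `L_{α,β}` on polynomials, with the derivatives carried out: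
`-A₁₁ ∂ₓ² - 2 A₁₂ ∂ₓ∂ᵧ - A₂₂ ∂ᵧ² + B₁ ∂ₓ + B₂ ∂ᵧ`. -/
def opL (α β : ℝ) (P : MvPolynomial (Fin 2) ℝ) : MvPolynomial (Fin 2) ℝ :=
  -A₁₁ * pderiv 0 (pderiv 0 P) - 2 * A₁₂ * pderiv 0 (pderiv 1 P)
    - A₂₂ * pderiv 1 (pderiv 1 P)
    + (C (21 + 12 * α + 18 * β) * X 0 + C (6 * α + 3)) * pderiv 0 P
    + (C (18 + 36 * α) * X 0 + C (45 + 36 * β + 18 * α) * X 1 + C (18 * β + 9)) * pderiv 1 P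

/-- The `m`-degree `|k|_* = 2k₁ + 3k₂`. -/
def mDeg (k : ℕ × ℕ) : ℕ := 2 * k.1 + 3 * k.2

/-- The eigenvalue `λ^{α,β}_{k₁,k₂}`. -/
def eigval (α β : ℝ) (k : ℕ × ℕ) : ℝ :=
  3 / 2 * mDeg k * (mDeg k + 5 + 4 * α + 6 * β) + 9 / 2 * k.2 * (k.2 + 1 + 2 * β)

/-- The space `Π*_n` of polynomials of `m`-degree at most `n`. -/
def PiStar (n : ℕ) : Submodule ℝ (MvPolynomial (Fin 2) ℝ) :=
  Submodule.span ℝ {P | ∃ j : ℕ × ℕ, mDeg j ≤ n ∧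
    P = MvPolynomial.X 0 ^ j.1 * MvPolynomial.X 1 ^ j.2}

/-- The strict `*`-order `k ≺ j`. -/
def StarLT (k j : ℕ × ℕ) : Prop :=
  mDeg k < mDeg j ∨
    (2 * ((k.1 : ℤ) - j.1) = 3 * ((j.2 : ℤ) - k.2) ∧ 0 < 3 * ((j.2 : ℤ) - k.2))

/-- The space `Π*_{k₁,k₂}` spanned by the monomials with exponent `j ≼ k` in the `*`-order. -/
def PiStarPair (k : ℕ × ℕ) : Submodule ℝ (MvPolynomial (Fin 2) ℝ) :=
  Submodule.span ℝ {P | ∃ j : ℕ × ℕ, (StarLT j k ∨ j = k) ∧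
    P = MvPolynomial.X 0 ^ j.1 * MvPolynomial.X 1 ^ j.2}

/-- `J` is the system of generalized Jacobi polynomials for `w_{α,β}`: the polynomial `J k`
has leading term `x^{k₁} y^{k₂}` in the `*`-order, is an eigenfunction of `L_{α,β}` for the
eigenvalue `λ^{α,β}_k`, and any two of them are orthogonal with respect to `w_{α,β}`. -/
structure IsJacobiSystem (α β : ℝ) (J : ℕ × ℕ → MvPolynomial (Fin 2) ℝ) : Prop where
  mem : ∀ k, J k ∈ PiStarPair k
  leading : ∀ k, (J k).coeff (Finsupp.single 0 k.1 + Finsupp.single 1 k.2) = 1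
  eigen : ∀ k, opL α β (J k) = MvPolynomial.C (eigval α β k) * J k
  integrable : ∀ k j,
    IntegrableOn (fun p => evalAt (J k) p * evalAt (J j) p * weight α β p) deltaStar
  orthogonal : ∀ k j, k ≠ j → innerW α β (J k) (J j) = 0

end

end G2Cheb

/-! Adjoining k ↦ -k to the group of order 6 gives the Weyl group W of type G₂, of order 12. Put r =
(α + 1/2, β + 1/2), so both entries are 0 or 1, and let the short and long simple reflections have
signs (-1)^r₁ and (-1)^r₂. In z = e^{is}, w = e^{it} the four families CC, SC, CS, SS are, up to a
constant, the signed orbit sums `alt r`, and all four Chebyshev definitions read Q · `alt r r` =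
`alt r (k + r)`: a Weyl character formula in which ω = `alt r r` is the denominator
(`isChebyshev_iff`).

Existence and leading term. x and y are one sixth of the sums over the short and the long roots, so
multiplying by 6x or 6y shifts the index of `alt` by these roots. Exactly one orbit among the
shifted weights is highest, and the *-order compares heights of dominant weights; well-founded
induction yields a polynomial quotient with leading monomial x^k₁ y^k₂ (`exists_rep`).

Eigenvalue equation. The W-invariant Laplacian D = (z∂_z)² - (z∂_z)(w∂_w) + (w∂_w)² acts on `alt r a
b` by the scalar N(a,b) = a² + 3ab + 3b². Expanding D(Qω) by the Leibniz and chain rules, and using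
that the cross terms of ω with x and y are polynomial multiples of ω, gives the explicit operator.
Its eigenvalue is 6(N(k + r) - N(r)) = λ_k (`pev_opL_mul_alt`).

Orthogonality. The map `chart` from a fundamental triangle of the torus onto △* is injective, and
Jacobian times weight is a constant times the square of a real multiple of the denominator. The
inner product thus becomes the integral of a product of two signed orbit sums; unfolded over W it is
a Fourier integral, zero for distinct dominant weights and nonzero for equal ones
(`exists_integral_weight`, `integral_orbSum_mul_orbSum`).

Uniqueness. The quotients are triangular over the monomials and the form is diagonal and
nondegenerate on them. Values on the open triangle therefore determine a polynomial, and a monic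
orthogonal system triangular for the *-order is unique, as in Gram–Schmidt. The monic multiples of
the quotients are such a system. -/

namespace G2Cheb

open MeasureTheory

noncomputable section

/-! ### Signed orbit sums for the Weyl group of type G₂ -/

/-- The Laurent monomial `z ^ p * w ^ q`. -/
def wt (p q : ℤ) (z w : ℂ) : ℂ := z ^ p * w ^ q

theorem wt_add {z w : ℂ} (hz : z ≠ 0) (hw : w ≠ 0) (p q p' q' : ℤ) :
    wt (p + p') (q + q') z w = wt p q z w * wt p' q' z w := by
  simp only [wt, zpow_add₀ hz, zpow_add₀ hw]; ring

/-- The orbit of the exponent `(p, q)` under the Weyl group of type `G₂`. -/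
def orb (p q : ℤ) : Fin 12 → ℤ × ℤ :=
  ![(p, q), (q - p, -p), (-q, p - q), (-p, q - p), (p - q, -q), (q, p),
    (-p, -q), (p - q, p), (q, q - p), (p, p - q), (q - p, q), (-q, -p)]

/-- The character of the Weyl group attached to a pair of signs. -/
def chi (ε δ : ℂ) : Fin 12 → ℂ :=
  ![1, 1, 1, ε, ε, ε, δ, δ, δ, δ * ε, δ * ε, δ * ε]

/-- The signed orbit sum. -/
def orbSum (ε δ : ℂ) (p q : ℤ) (z w : ℂ) : ℂ :=
  ∑ i, chi ε δ i * wt (orb p q i).1 (orb p q i).2 z w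

theorem orbSum_eq (ε δ : ℂ) (p q : ℤ) (z w : ℂ) : orbSum ε δ p q z w =
    wt p q z w + wt (q - p) (-p) z w + wt (-q) (p - q) z w
    + ε * (wt (-p) (q - p) z w + wt (p - q) (-q) z w + wt q p z w)
    + δ * (wt (-p) (-q) z w + wt (p - q) p z w + wt q (q - p) z w
    + ε * (wt p (p - q) z w + wt (q - p) q z w + wt (-q) (-p) z w)) := by
  simp [orbSum, chi, orb, Fin.sum_univ_succ]
  ring

/-- The signed orbit sum in coordinates with respect to the fundamental weights. -/
def alt (r : ℕ × ℕ) (a b : ℤ) (z w : ℂ) : ℂ :=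
  orbSum ((-1) ^ r.2) ((-1) ^ (r.1 + r.2)) (a + b) (a + 2 * b) z w

/-- The variable `x` as a Laurent polynomial. -/
def lx (z w : ℂ) : ℂ := (z + z⁻¹ + w + w⁻¹ + z * w + z⁻¹ * w⁻¹) / 6

/-- The variable `y` as a Laurent polynomial. -/
def ly (z w : ℂ) : ℂ :=
  (z * w⁻¹ + z⁻¹ * w + z ^ 2 * w + z⁻¹ ^ 2 * w⁻¹ + z * w ^ 2 + z⁻¹ * w⁻¹ ^ 2) / 6

/-- Moving the exponent by a group element permutes the orbit and multiplies every sign by the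
character of that element. Here and in `orbSum_reflect` the element is a reflection; the two
together generate the group. -/
theorem orbSum_swap {ε : ℂ} (hε : ε ^ 2 = 1) (δ : ℂ) (p q : ℤ) (z w : ℂ) :
    orbSum ε δ q p z w = ε * orbSum ε δ p q z w := by
  simp only [orbSum_eq]
  linear_combination (-(wt (-p) (q - p) z w + wt (p - q) (-q) z w + wt q p z w)
    - δ * (wt p (p - q) z w + wt (q - p) q z w + wt (-q) (-p) z w)) * hε

theorem orbSum_reflect {ε δ : ℂ} (hε : ε ^ 2 = 1) (hδ : δ ^ 2 = 1) (p q : ℤ) (z w : ℂ) :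
    orbSum ε δ (q - p) q z w = δ * ε * orbSum ε δ p q z w := by
  have h1 : q - (q - p) = p := by ring
  have h2 : q - p - q = -p := by ring
  simp only [orbSum_eq, neg_sub, h1, h2]
  linear_combination (-δ * (wt (-p) (q - p) z w + wt (p - q) (-q) z w + wt q p z w)
    - (wt p (p - q) z w + wt (q - p) q z w + wt (-q) (-p) z w)) * hε
    + (-ε * (wt (-p) (-q) z w + wt (p - q) p z w + wt q (q - p) z w)
    - ε ^ 2 * (wt p (p - q) z w + wt (q - p) q z w + wt (-q) (-p) z w)) * hδ

theorem neg_one_pow_sq (n : ℕ) : ((-1 : ℂ) ^ n) ^ 2 = 1 := by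
  rw [← pow_mul, mul_comm, pow_mul]; simp

/-- In the coordinates of the fundamental weights the two generators become the simple reflections.
The sign is δε = (-1)^(r₁ + 2r₂) = (-1)^r₁ here and ε = (-1)^r₂ in `alt_reflect_two`. -/
theorem alt_reflect_one (r : ℕ × ℕ) (a b : ℤ) (z w : ℂ) :
    alt r (-a) (a + b) z w = (-1) ^ r.1 * alt r a b z w := by
  have := orbSum_reflect (neg_one_pow_sq r.2) (neg_one_pow_sq (r.1 + r.2)) (a + b) (a + 2 * b) z w
  have h : ((-1 : ℂ) ^ (r.1 + r.2)) * (-1) ^ r.2 = (-1) ^ r.1 := by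
    rw [pow_add, mul_assoc, ← sq, neg_one_pow_sq, mul_one]
  rw [h] at this
  rw [alt, alt, ← this]
  ring_nf

theorem alt_reflect_two (r : ℕ × ℕ) (a b : ℤ) (z w : ℂ) :
    alt r (a + 3 * b) (-b) z w = (-1) ^ r.2 * alt r a b z w := by
  rw [alt, alt, ← orbSum_swap (neg_one_pow_sq r.2)]
  ring_nf

theorem lx_eq (z w : ℂ) : lx z w = (wt 1 0 z w + wt (-1) 0 z w + wt 0 1 z w + wt 0 (-1) z w
    + wt 1 1 z w + wt (-1) (-1) z w) / 6 := by
  simp [lx, wt]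

theorem ly_eq (z w : ℂ) : ly z w = (wt 1 (-1) z w + wt (-1) 1 z w + wt 2 1 z w
    + wt (-2) (-1) z w + wt 1 2 z w + wt (-1) (-2) z w) / 6 := by
  simp [ly, wt, zpow_neg, zpow_ofNat]

/-- The exponents of x are the six short roots, a set stable under the group. Multiplying each term
of the orbit by x therefore shifts the base exponent by the six short roots. For y the same holds
with the six long roots. -/
theorem lx_mul_orbSum (ε δ : ℂ) (p q : ℤ) {z w : ℂ} (hz : z ≠ 0) (hw : w ≠ 0) :
    6 * lx z w * orbSum ε δ p q z w = orbSum ε δ (p + 1) (q + 1) z w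
      + orbSum ε δ (p - 1) (q - 1) z w + orbSum ε δ p (q + 1) z w + orbSum ε δ p (q - 1) z w
      + orbSum ε δ (p + 1) q z w + orbSum ε δ (p - 1) q z w := by
  rw [lx_eq, mul_div_cancel₀ _ (by norm_num)]
  simp only [orbSum_eq, mul_add, add_mul, mul_left_comm (wt _ _ _ _) ε,
    mul_left_comm (wt _ _ _ _) δ, ← wt_add hz hw]
  ring_nf

theorem ly_mul_orbSum (ε δ : ℂ) (p q : ℤ) {z w : ℂ} (hz : z ≠ 0) (hw : w ≠ 0) :
    6 * ly z w * orbSum ε δ p q z w = orbSum ε δ (p + 1) (q + 2) z w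
      + orbSum ε δ (p - 1) (q - 2) z w + orbSum ε δ (p + 1) (q - 1) z w
      + orbSum ε δ (p - 1) (q + 1) z w + orbSum ε δ (p + 2) (q + 1) z w
      + orbSum ε δ (p - 2) (q - 1) z w := by
  rw [ly_eq, mul_div_cancel₀ _ (by norm_num)]
  simp only [orbSum_eq, mul_add, add_mul, mul_left_comm (wt _ _ _ _) ε,
    mul_left_comm (wt _ _ _ _) δ, ← wt_add hz hw]
  ring_nf

theorem lx_mul_alt (r : ℕ × ℕ) (a b : ℤ) {z w : ℂ} (hz : z ≠ 0) (hw : w ≠ 0) :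
    6 * lx z w * alt r a b z w = alt r (a + 1) b z w + alt r (a - 1) b z w
      + alt r (a - 1) (b + 1) z w + alt r (a + 1) (b - 1) z w
      + alt r (a + 2) (b - 1) z w + alt r (a - 2) (b + 1) z w := by
  simp only [alt, lx_mul_orbSum _ _ _ _ hz hw]
  ring_nf

theorem ly_mul_alt (r : ℕ × ℕ) (a b : ℤ) {z w : ℂ} (hz : z ≠ 0) (hw : w ≠ 0) :
    6 * ly z w * alt r a b z w = alt r a (b + 1) z w + alt r a (b - 1) z w
      + alt r (a + 3) (b - 2) z w + alt r (a - 3) (b + 2) z w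
      + alt r (a + 3) (b - 1) z w + alt r (a - 3) (b + 1) z w := by
  simp only [alt, ly_mul_orbSum _ _ _ _ hz hw]
  ring_nf

/-! ### Polynomial representatives and the *-order -/

/-- The value of a real polynomial at the pair of Laurent polynomials `(x, y)`. -/
def pev (P : MvPolynomial (Fin 2) ℝ) (z w : ℂ) : ℂ := MvPolynomial.aeval ![lx z w, ly z w] P

/-- The monomial `x ^ k₁ * y ^ k₂`. -/
def mono (k : ℕ × ℕ) : MvPolynomial (Fin 2) ℝ :=
  MvPolynomial.X 0 ^ k.1 * MvPolynomial.X 1 ^ k.2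

/-- The span of the monomials strictly below `k` in the `*`-order. -/
def PiLT (k : ℕ × ℕ) : Submodule ℝ (MvPolynomial (Fin 2) ℝ) :=
  Submodule.span ℝ {P | ∃ j : ℕ × ℕ, StarLT j k ∧ P = mono j}

/-- `Q` represents the quotient of `alt r (k + r)` by `alt r r`. -/
def IsRep (r k : ℕ × ℕ) (Q : MvPolynomial (Fin 2) ℝ) : Prop :=
  ∀ z w : ℂ, z ≠ 0 → w ≠ 0 →
    pev Q z w * alt r r.1 r.2 z w = alt r (k.1 + r.1) (k.2 + r.2) z w

/-- `f` is the product of `alt r r` with a polynomial strictly below `k`. -/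
def IsLow (r k : ℕ × ℕ) (f : ℂ → ℂ → ℂ) : Prop :=
  ∃ P ∈ PiLT k, ∀ z w : ℂ, z ≠ 0 → w ≠ 0 → pev P z w * alt r r.1 r.2 z w = f z w

/-- `Q` has leading monomial `k`. -/
def HasLead (k : ℕ × ℕ) (Q : MvPolynomial (Fin 2) ℝ) : Prop :=
  ∃ c : ℝ, c ≠ 0 ∧ Q - c • mono k ∈ PiLT k

theorem IsLow.add {r k : ℕ × ℕ} {f g : ℂ → ℂ → ℂ} (hf : IsLow r k f) (hg : IsLow r k g) :
    IsLow r k (fun z w => f z w + g z w) := by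
  obtain ⟨P, hP, h⟩ := hf
  obtain ⟨R, hR, h'⟩ := hg
  refine ⟨P + R, add_mem hP hR, fun z w hz hw => ?_⟩
  change _ = f z w + g z w
  rw [← h z w hz hw, ← h' z w hz hw, pev, map_add, add_mul]; rfl

theorem IsLow.smul {r k : ℕ × ℕ} {f : ℂ → ℂ → ℂ} (c : ℝ) (hf : IsLow r k f) :
    IsLow r k (fun z w => c * f z w) := by
  obtain ⟨P, hP, h⟩ := hf
  refine ⟨c • P, Submodule.smul_mem _ _ hP, fun z w hz hw => ?_⟩
  change _ = c * f z w
  rw [← h z w hz hw, pev, map_smul, Complex.real_smul, mul_assoc]; rfl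

theorem starLT_trans {i j k : ℕ × ℕ} (h : StarLT i j) (h' : StarLT j k) : StarLT i k := by
  unfold StarLT mDeg at *; omega

theorem PiLT_mono {j k : ℕ × ℕ} (h : StarLT j k) : PiLT j ≤ PiLT k :=
  Submodule.span_mono fun _ ⟨i, hi, e⟩ => ⟨i, starLT_trans hi h, e⟩

theorem mono_mem_PiLT {j k : ℕ × ℕ} (h : StarLT j k) : mono j ∈ PiLT k :=
  Submodule.subset_span ⟨j, h, rfl⟩

theorem HasLead.mem_PiLT {j k : ℕ × ℕ} {Q : MvPolynomial (Fin 2) ℝ} (hQ : HasLead j Q)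
    (h : StarLT j k) : Q ∈ PiLT k := by
  obtain ⟨c, -, hc⟩ := hQ
  rw [← sub_add_cancel Q (c • mono j)]
  exact add_mem (PiLT_mono h hc) (Submodule.smul_mem _ _ (mono_mem_PiLT h))

theorem mono_mul_mono (i j : ℕ × ℕ) : mono i * mono j = mono (i + j) := by
  simp only [mono, Prod.fst_add, Prod.snd_add, pow_add]; ring

theorem mono_mul_mem_PiLT (i : ℕ × ℕ) {k : ℕ × ℕ} {P : MvPolynomial (Fin 2) ℝ}
    (h : P ∈ PiLT k) : mono i * P ∈ PiLT (i + k) := by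
  induction h using Submodule.span_induction with
  | mem P h =>
    obtain ⟨j, hj, rfl⟩ := h
    rw [mono_mul_mono]
    apply mono_mem_PiLT
    simp only [StarLT, mDeg, Prod.fst_add, Prod.snd_add] at *
    push_cast at *
    omega
  | zero => simp
  | add P R _ _ hP hR => rw [mul_add]; exact add_mem hP hR
  | smul c P _ hP => rw [mul_smul_comm]; exact Submodule.smul_mem _ _ hP

theorem HasLead.mono_mul (i : ℕ × ℕ) {k : ℕ × ℕ} {Q : MvPolynomial (Fin 2) ℝ}
    (h : HasLead k Q) : HasLead (i + k) (mono i * Q) := by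
  obtain ⟨c, hc, h⟩ := h
  refine ⟨c, hc, ?_⟩
  have := mono_mul_mem_PiLT i h
  rwa [mul_sub, mul_smul_comm, mono_mul_mono] at this

/-! ### Existence of the quotients by induction on the height -/

/-- The maximal value of `2a + 3b` over the orbit of `(a, b)`. -/
def hgt (a b : ℤ) : ℕ := max (2 * a + 3 * b).natAbs (max (a + 3 * b).natAbs a.natAbs)

/-- The maximal value of `a + 2b` over the orbit of `(a, b)`. -/
def hgt' (a b : ℤ) : ℕ := max (a + 2 * b).natAbs (max (a + b).natAbs b.natAbs)

theorem hgt_lt_iff (a b : ℤ) (n : ℕ) : hgt a b < n ↔ 2 * a + 3 * b < n ∧ -n < 2 * a + 3 * b ∧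
    a + 3 * b < n ∧ -n < a + 3 * b ∧ a < n ∧ -n < a := by
  simp only [hgt, max_lt_iff]; omega

theorem hgt_le_iff (a b : ℤ) (n : ℕ) : hgt a b ≤ n ↔ 2 * a + 3 * b ≤ n ∧ -n ≤ 2 * a + 3 * b ∧
    a + 3 * b ≤ n ∧ -n ≤ a + 3 * b ∧ a ≤ n ∧ -n ≤ a := by
  simp only [hgt, max_le_iff]; omega

theorem hgt'_lt_iff (a b : ℤ) (n : ℕ) : hgt' a b < n ↔ a + 2 * b < n ∧ -n < a + 2 * b ∧
    a + b < n ∧ -n < a + b ∧ b < n ∧ -n < b := by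
  simp only [hgt', max_lt_iff]; omega

/-- Reflecting in a simple root with negative coordinate raises 3a + 5b = (2a + 3b) + (a + 2b) by -b
or -a and leaves both heights fixed. Since 3a + 5b never exceeds the sum of the heights, the gap n
is a termination measure; gap zero already forces a, b ≥ 0. -/
theorem exists_dominant (r : ℕ × ℕ) (n : ℕ) : ∀ a b : ℤ,
    (hgt a b : ℤ) + hgt' a b - (3 * a + 5 * b) ≤ n →
    ∃ a' b' : ℕ, hgt a' b' = hgt a b ∧ hgt' a' b' = hgt' a b ∧
      ∃ s : ℝ, ∀ z w, alt r a b z w = s * alt r a' b' z w := by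
  induction n with
  | zero =>
    intro a b h
    refine ⟨a.toNat, b.toNat, ?_⟩
    have ha : (a.toNat : ℤ) = a := by unfold hgt hgt' at h; omega
    have hb : (b.toNat : ℤ) = b := by unfold hgt hgt' at h; omega
    rw [ha, hb]
    exact ⟨rfl, rfl, 1, by simp⟩
  | succ n ih =>
    intro a b h
    by_cases hb : b < 0
    · have e1 : hgt (a + 3 * b) (-b) = hgt a b := by unfold hgt; omega
      have e2 : hgt' (a + 3 * b) (-b) = hgt' a b := by unfold hgt'; omega
      obtain ⟨a', b', h1, h2, s, hs⟩ := ih (a + 3 * b) (-b) (by rw [e1, e2]; push_cast at h; omega)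
      refine ⟨a', b', h1.trans e1, h2.trans e2, (-1) ^ r.2 * s, fun z w => ?_⟩
      have := hs z w
      rw [alt_reflect_two] at this
      push_cast
      rw [mul_assoc, ← this, ← mul_assoc, ← sq, neg_one_pow_sq, one_mul]
    by_cases ha : a < 0
    · have e1 : hgt (-a) (a + b) = hgt a b := by unfold hgt; omega
      have e2 : hgt' (-a) (a + b) = hgt' a b := by unfold hgt'; omega
      obtain ⟨a', b', h1, h2, s, hs⟩ := ih (-a) (a + b) (by rw [e1, e2]; push_cast at h; omega)
      refine ⟨a', b', h1.trans e1, h2.trans e2, (-1) ^ r.1 * s, fun z w => ?_⟩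
      have := hs z w
      rw [alt_reflect_one] at this
      push_cast
      rw [mul_assoc, ← this, ← mul_assoc, ← sq, neg_one_pow_sq, one_mul]
    refine ⟨a.toNat, b.toNat, ?_⟩
    have ha : (a.toNat : ℤ) = a := by omega
    have hb : (b.toNat : ℤ) = b := by omega
    rw [ha, hb]
    exact ⟨rfl, rfl, 1, by simp⟩

/-- A weight on a wall is fixed by the corresponding reflection, which changes the sign of the sum.
-/
theorem alt_zero_left {r : ℕ × ℕ} (h : r.1 = 1) (b : ℤ) (z w : ℂ) : alt r 0 b z w = 0 := by
  have := alt_reflect_one r 0 b z w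
  rw [h] at this
  simp only [neg_zero, zero_add] at this
  linear_combination this / 2

theorem alt_zero_right {r : ℕ × ℕ} (h : r.2 = 1) (a : ℤ) (z w : ℂ) : alt r a 0 z w = 0 := by
  have := alt_reflect_two r a 0 z w
  rw [h] at this
  simp only [neg_zero, mul_zero, add_zero] at this
  linear_combination this / 2

theorem isLow_zero (r k : ℕ × ℕ) : IsLow r k (fun _ _ => 0) :=
  ⟨0, zero_mem _, fun z w _ _ => by simp [pev]⟩

/-- For dominant weights the heights are 2a + 3b and a + 2b themselves. Subtracting r turns the
first into the m-degree; when the m-degrees agree, a smaller a + 2b means a smaller second exponent,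
which is the second clause of the *-order. -/
theorem starLT_of_hgt {r k : ℕ × ℕ} {a b : ℕ} (ha : r.1 ≤ a) (hb : r.2 ≤ b)
    (h : hgt a b < 2 * (k.1 + r.1) + 3 * (k.2 + r.2) ∨
      (hgt a b ≤ 2 * (k.1 + r.1) + 3 * (k.2 + r.2) ∧ hgt' a b < k.1 + r.1 + 2 * (k.2 + r.2))) :
    StarLT (a - r.1, b - r.2) k := by
  have e1 : hgt a b = 2 * a + 3 * b := by unfold hgt; omega
  have e2 : hgt' a b = a + 2 * b := by unfold hgt'; omega
  rw [e1, e2] at h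
  unfold StarLT mDeg
  push_cast [ha, hb]
  omega

/-- After reflection to the dominant chamber the weight either lies on a wall with sign -1, where
the sum vanishes, or has the form j + r with j strictly below k, where the induction hypothesis
supplies a polynomial. -/
theorem isLow_alt {r k : ℕ × ℕ} (h1 : r.1 ≤ 1) (h2 : r.2 ≤ 1)
    (ih : ∀ j, StarLT j k → ∃ Q, HasLead j Q ∧ IsRep r j Q) (a b : ℤ)
    (h : hgt a b < 2 * (k.1 + r.1) + 3 * (k.2 + r.2) ∨
      (hgt a b ≤ 2 * (k.1 + r.1) + 3 * (k.2 + r.2) ∧ hgt' a b < k.1 + r.1 + 2 * (k.2 + r.2))) :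
    IsLow r k (alt r a b) := by
  obtain ⟨a', b', e1, e2, s, hs⟩ := exists_dominant r
    ((hgt a b : ℤ) + hgt' a b - (3 * a + 5 * b)).toNat a b (Int.self_le_toNat _)
  have hs' : alt r a b = fun z w => s * alt r a' b' z w := by ext z w; exact hs z w
  rw [hs']
  refine IsLow.smul s ?_
  by_cases ha : a' < r.1
  · have : alt r (a' : ℤ) b' = fun _ _ => 0 := by
      ext z w
      rw [show a' = 0 by omega]
      exact alt_zero_left (by omega) _ _ _
    rw [this]
    exact isLow_zero r k
  by_cases hb : b' < r.2
  · have : alt r (a' : ℤ) b' = fun _ _ => 0 := by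
      ext z w
      rw [show b' = 0 by omega]
      exact alt_zero_right (by omega) _ _ _
    rw [this]
    exact isLow_zero r k
  have hlt : StarLT (a' - r.1, b' - r.2) k := by
    rw [← e1, ← e2] at h
    exact starLT_of_hgt (by omega) (by omega) h
  obtain ⟨Q, hQ, hr⟩ := ih _ hlt
  refine ⟨Q, hQ.mem_PiLT hlt, fun z w hz hw => ?_⟩
  rw [hr z w hz hw]
  congr 1 <;> · simp only; omega

/-- The inductive step: solving 6Rω = n · `alt r (k + r)` + (lower terms) for the middle sum keeps
the leading monomial of R, since the correction is strictly below k. -/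
theorem exists_rep_of_mul {r k : ℕ × ℕ} {R : MvPolynomial (Fin 2) ℝ} (hR : HasLead k R) {n : ℝ}
    (hn : n ≠ 0) {f : ℂ → ℂ → ℂ} (hf : IsLow r k f)
    (h : ∀ z w : ℂ, z ≠ 0 → w ≠ 0 → 6 * (pev R z w * alt r r.1 r.2 z w)
      = n * alt r (k.1 + r.1) (k.2 + r.2) z w + f z w) :
    ∃ Q, HasLead k Q ∧ IsRep r k Q := by
  obtain ⟨P, hP, e⟩ := hf
  obtain ⟨c, hc, hRc⟩ := hR
  refine ⟨n⁻¹ • ((6 : ℝ) • R - P), ⟨n⁻¹ * 6 * c, by positivity, ?_⟩, fun z w hz hw => ?_⟩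
  · have : n⁻¹ • ((6 : ℝ) • R - P) - (n⁻¹ * 6 * c) • mono k
        = n⁻¹ • ((6 : ℝ) • (R - c • mono k) - P) := by module
    rw [this]
    exact Submodule.smul_mem _ _ (sub_mem (Submodule.smul_mem _ _ hRc) hP)
  · have h1 := h z w hz hw
    have h2 := e z w hz hw
    have hn' : (n : ℂ) ≠ 0 := by exact_mod_cast hn
    simp only [pev, map_smul, map_sub, Complex.real_smul] at *
    push_cast
    rw [← h2] at h1
    field_simp
    linear_combination h1

/-- The *-order is contained in the lexicographic order of (m-degree, second exponent). -/
theorem wellFounded_starLT : WellFounded StarLT := by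
  have : WellFounded (InvImage (Prod.Lex (· < ·) (· < ·)) fun k : ℕ × ℕ => (mDeg k, k.2)) :=
    InvImage.wf _ (WellFounded.prod_lex wellFounded_lt wellFounded_lt)
  refine Subrelation.wf (fun {i j} h => ?_) this
  simp only [InvImage, Prod.lex_def, StarLT, mDeg] at *
  omega

theorem pev_mul (P R : MvPolynomial (Fin 2) ℝ) (z w : ℂ) :
    pev (P * R) z w = pev P z w * pev R z w := map_mul _ _ _

theorem pev_mono (k : ℕ × ℕ) (z w : ℂ) : pev (mono k) z w = lx z w ^ k.1 * ly z w ^ k.2 := by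
  simp [pev, mono]

theorem exists_rep_zero (r : ℕ × ℕ) : ∃ Q, HasLead (0, 0) Q ∧ IsRep r (0, 0) Q :=
  ⟨1, ⟨1, one_ne_zero, by simp [mono]⟩, fun z w _ _ => by simp [pev]⟩

/-- The representative for (u, v) is multiplied by x. With a = u + r₁ and b = v + r₂, the constant n
counts the short roots that move (a, b) into the orbit of (a + 1, b): all six if a = b = 0, two if
only a = 0, because (-1, b + 1) reflects to (1, b), and one otherwise. The remaining shifts are
lower. -/
theorem exists_rep_x {r : ℕ × ℕ} (h1 : r.1 ≤ 1) (h2 : r.2 ≤ 1) (u v : ℕ)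
    (ih : ∀ j, StarLT j (u + 1, v) → ∃ Q, HasLead j Q ∧ IsRep r j Q) :
    ∃ Q, HasLead (u + 1, v) Q ∧ IsRep r (u + 1, v) Q := by
  obtain ⟨Q, hQ, hr⟩ := ih (u, v) (by unfold StarLT mDeg; left; simp only; omega)
  have hl := hQ.mono_mul (1, 0)
  rw [Prod.mk_add_mk, add_comm 1 u, zero_add] at hl
  have key : ∀ z w : ℂ, z ≠ 0 → w ≠ 0 → 6 * (pev (mono (1, 0) * Q) z w * alt r r.1 r.2 z w)
      = alt r (u + r.1 + 1) (v + r.2) z w + alt r (u + r.1 - 1) (v + r.2) z w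
      + alt r (u + r.1 - 1) (v + r.2 + 1) z w + alt r (u + r.1 + 1) (v + r.2 - 1) z w
      + alt r (u + r.1 + 2) (v + r.2 - 1) z w + alt r (u + r.1 - 2) (v + r.2 + 1) z w := by
    intro z w hz hw
    rw [← lx_mul_alt r _ _ hz hw, pev_mul, pev_mono]
    linear_combination 6 * lx z w * hr z w hz hw
  have low := fun a b => isLow_alt h1 h2 ih a b
  have e : ((u : ℤ) + r.1 + 1) = ((u + 1 : ℕ) : ℤ) + r.1 := by push_cast; ring
  simp only at low
  rcases Nat.eq_zero_or_pos (u + r.1) with ha | ha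
  · have hu : u = 0 := by omega
    have hr1 : r.1 = 0 := by omega
    rcases Nat.eq_zero_or_pos (v + r.2) with hb | hb
    · have hv : v = 0 := by omega
      have hr2 : r.2 = 0 := by omega
      refine exists_rep_of_mul hl (n := 6) (by norm_num) (isLow_zero r _) fun z w hz hw => ?_
      rw [key z w hz hw]
      subst hu hv
      simp only [hr1, hr2]
      have s1 := fun a b => alt_reflect_one r a b z w
      have s2 := fun a b => alt_reflect_two r a b z w
      simp only [hr1, hr2, pow_zero, one_mul] at s1 s2
      have t1 : alt r (-1) 1 z w = alt r 1 0 z w := by rw [← s1 1 0]; norm_num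
      have t2 : alt r 2 (-1) z w = alt r (-1) 1 z w := by rw [← s2 (-1) 1]; norm_num
      have t3 : alt r (-2) 1 z w = alt r 2 (-1) z w := by rw [← s1 2 (-1)]; norm_num
      have t4 : alt r 1 (-1) z w = alt r (-2) 1 z w := by rw [← s2 (-2) 1]; norm_num
      have t5 : alt r (-1) 0 z w = alt r 1 (-1) z w := by rw [← s1 1 (-1)]; norm_num
      norm_num
      rw [t5, t4, t3, t2, t1]
      ring
    · refine exists_rep_of_mul hl (n := 2) two_ne_zero
        ((((low (u + r.1 - 1) (v + r.2) ?_).add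
        (low (u + r.1 + 1) (v + r.2 - 1) ?_)).add (low (u + r.1 + 2) (v + r.2 - 1) ?_)).add
        (low (u + r.1 - 2) (v + r.2 + 1) ?_)) fun z w hz hw => ?_
      · rw [hgt_lt_iff, hgt_le_iff, hgt'_lt_iff]; omega
      · rw [hgt_lt_iff, hgt_le_iff, hgt'_lt_iff]; omega
      · rw [hgt_lt_iff, hgt_le_iff, hgt'_lt_iff]; omega
      · rw [hgt_lt_iff, hgt_le_iff, hgt'_lt_iff]; omega
      · have t1 := alt_reflect_one r 1 (v + r.2) z w
        rw [key z w hz hw]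
        subst hu
        simp only [hr1, pow_zero, one_mul] at t1 ⊢
        norm_num at t1 ⊢
        rw [add_comm (1 : ℤ)] at t1
        rw [t1]
        ring
  · refine exists_rep_of_mul hl (n := 1) one_ne_zero
      (((((low (u + r.1 - 1) (v + r.2) ?_).add (low (u + r.1 - 1) (v + r.2 + 1) ?_)).add
      (low (u + r.1 + 1) (v + r.2 - 1) ?_)).add (low (u + r.1 + 2) (v + r.2 - 1) ?_)).add
      (low (u + r.1 - 2) (v + r.2 + 1) ?_)) fun z w hz hw => ?_
    · rw [hgt_lt_iff, hgt_le_iff, hgt'_lt_iff]; omega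
    · rw [hgt_lt_iff, hgt_le_iff, hgt'_lt_iff]; omega
    · rw [hgt_lt_iff, hgt_le_iff, hgt'_lt_iff]; omega
    · rw [hgt_lt_iff, hgt_le_iff, hgt'_lt_iff]; omega
    · rw [hgt_lt_iff, hgt_le_iff, hgt'_lt_iff]; omega
    · rw [key z w hz hw, e]; push_cast; ring

/-- Only k₁ = 0 is needed, as the other indices are reached by multiplying by x. The long root (3,
-1) keeps 2a + 3b at its new maximum, so the second height is what places its term below the leading
one. -/
theorem exists_rep_y {r : ℕ × ℕ} (h1 : r.1 ≤ 1) (h2 : r.2 ≤ 1) (v : ℕ)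
    (ih : ∀ j, StarLT j (0, v + 1) → ∃ Q, HasLead j Q ∧ IsRep r j Q) :
    ∃ Q, HasLead (0, v + 1) Q ∧ IsRep r (0, v + 1) Q := by
  obtain ⟨Q, hQ, hr⟩ := ih (0, v) (by unfold StarLT mDeg; left; simp only; omega)
  have hl := hQ.mono_mul (0, 1)
  rw [Prod.mk_add_mk, add_comm 1 v, zero_add] at hl
  have key : ∀ z w : ℂ, z ≠ 0 → w ≠ 0 → 6 * (pev (mono (0, 1) * Q) z w * alt r r.1 r.2 z w)
      = alt r r.1 (v + r.2 + 1) z w + alt r r.1 (v + r.2 - 1) z w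
      + alt r (r.1 + 3) (v + r.2 - 2) z w + alt r (r.1 - 3) (v + r.2 + 2) z w
      + alt r (r.1 + 3) (v + r.2 - 1) z w + alt r (r.1 - 3) (v + r.2 + 1) z w := by
    intro z w hz hw
    rw [← ly_mul_alt r _ _ hz hw, pev_mul, pev_mono]
    have := hr z w hz hw
    simp only [Nat.cast_zero, zero_add] at this
    linear_combination 6 * ly z w * this
  have low := fun a b => isLow_alt h1 h2 ih a b
  have e : ((v : ℤ) + r.2 + 1) = ((v + 1 : ℕ) : ℤ) + r.2 := by push_cast; ring
  simp only at low
  rcases Nat.eq_zero_or_pos (v + r.2) with hb | hb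
  · have hv : v = 0 := by omega
    have hr2 : r.2 = 0 := by omega
    subst hv
    rcases Nat.eq_zero_or_pos r.1 with ha | ha
    · refine exists_rep_of_mul hl (n := 6) (by norm_num) (isLow_zero r _) fun z w hz hw => ?_
      rw [key z w hz hw]
      simp only [hr2, ha]
      have s1 := fun a b => alt_reflect_one r a b z w
      have s2 := fun a b => alt_reflect_two r a b z w
      simp only [hr2, ha, pow_zero, one_mul] at s1 s2
      have t1 : alt r 3 (-1) z w = alt r 0 1 z w := by rw [← s2 0 1]; norm_num
      have t2 : alt r (-3) 2 z w = alt r 3 (-1) z w := by rw [← s1 3 (-1)]; norm_num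
      have t3 : alt r 3 (-2) z w = alt r (-3) 2 z w := by rw [← s2 (-3) 2]; norm_num
      have t4 : alt r (-3) 1 z w = alt r 3 (-2) z w := by rw [← s1 3 (-2)]; norm_num
      have t5 : alt r 0 (-1) z w = alt r (-3) 1 z w := by rw [← s2 (-3) 1]; norm_num
      norm_num
      rw [t5, t4, t3, t2, t1]
      ring
    -- Here b = 0, and the shifts (a, 1) and (a + 3, -1) are exchanged by the long simple
    -- reflection, whose sign is 1 as r₂ = 0.
    · refine exists_rep_of_mul hl (n := 2) two_ne_zero
        ((((low r.1 (-1) ?_).add (low (r.1 + 3) (-2) ?_)).add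
        (low (r.1 - 3) 2 ?_)).add (low (r.1 - 3) 1 ?_)) fun z w hz hw => ?_
      · rw [hgt_lt_iff, hgt_le_iff, hgt'_lt_iff]; omega
      · rw [hgt_lt_iff, hgt_le_iff, hgt'_lt_iff]; omega
      · rw [hgt_lt_iff, hgt_le_iff, hgt'_lt_iff]; omega
      · rw [hgt_lt_iff, hgt_le_iff, hgt'_lt_iff]; omega
      · have t1 := alt_reflect_two r r.1 1 z w
        rw [key z w hz hw]
        simp only [hr2, pow_zero, one_mul] at t1 ⊢
        norm_num at t1 ⊢
        rw [t1]
        ring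
  · refine exists_rep_of_mul hl (n := 1) one_ne_zero
      (((((low r.1 (v + r.2 - 1) ?_).add (low (r.1 + 3) (v + r.2 - 2) ?_)).add
      (low (r.1 - 3) (v + r.2 + 2) ?_)).add (low (r.1 + 3) (v + r.2 - 1) ?_)).add
      (low (r.1 - 3) (v + r.2 + 1) ?_)) fun z w hz hw => ?_
    · rw [hgt_lt_iff, hgt_le_iff, hgt'_lt_iff]; omega
    · rw [hgt_lt_iff, hgt_le_iff, hgt'_lt_iff]; omega
    · rw [hgt_lt_iff, hgt_le_iff, hgt'_lt_iff]; omega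
    · rw [hgt_lt_iff, hgt_le_iff, hgt'_lt_iff]; omega
    · rw [hgt_lt_iff, hgt_le_iff, hgt'_lt_iff]; omega
    · rw [key z w hz hw, e]
      simp only [Nat.cast_zero, zero_add]
      push_cast
      ring

theorem exists_rep {r : ℕ × ℕ} (h1 : r.1 ≤ 1) (h2 : r.2 ≤ 1) (k : ℕ × ℕ) :
    ∃ Q, HasLead k Q ∧ IsRep r k Q := by
  induction k using wellFounded_starLT.induction with
  | _ k ih =>
    obtain ⟨_ | u, _ | v⟩ := k
    · exact exists_rep_zero r
    · exact exists_rep_y h1 h2 v ih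
    · exact exists_rep_x h1 h2 u 0 ih
    · exact exists_rep_x h1 h2 u (v + 1) ih

/-! ### Euler derivatives and the eigenvalue equation -/

/-- `F₁ = z ∂F/∂z` and `F₂ = w ∂F/∂w` away from the axes. -/
def HasEuler (F F₁ F₂ : ℂ → ℂ → ℂ) : Prop :=
  ∀ z w : ℂ, z ≠ 0 → w ≠ 0 →
    HasDerivAt (fun s => F s w) (F₁ z w / z) z ∧ HasDerivAt (fun s => F z s) (F₂ z w / w) w

theorem HasEuler.add {F F₁ F₂ G G₁ G₂ : ℂ → ℂ → ℂ} (hF : HasEuler F F₁ F₂)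
    (hG : HasEuler G G₁ G₂) : HasEuler (F + G) (F₁ + G₁) (F₂ + G₂) := by
  intro z w hz hw
  have a := (hF z w hz hw).1.add (hG z w hz hw).1
  have b := (hF z w hz hw).2.add (hG z w hz hw).2
  rw [← add_div] at a b
  exact ⟨a, b⟩

theorem HasEuler.mul {F F₁ F₂ G G₁ G₂ : ℂ → ℂ → ℂ} (hF : HasEuler F F₁ F₂)
    (hG : HasEuler G G₁ G₂) : HasEuler (F * G) (F₁ * G + F * G₁) (F₂ * G + F * G₂) := by
  intro z w hz hw
  have a := (hF z w hz hw).1.mul (hG z w hz hw).1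
  have b := (hF z w hz hw).2.mul (hG z w hz hw).2
  refine ⟨a.congr_deriv ?_, b.congr_deriv ?_⟩ <;> simp only [Pi.add_apply, Pi.mul_apply] <;> ring

theorem HasEuler.const (c : ℂ) : HasEuler (fun _ _ => c) 0 0 := by
  intro z w hz hw
  simpa using ⟨hasDerivAt_const z c, hasDerivAt_const w c⟩

theorem HasEuler.congr {F F₁ F₂ G₁ G₂ : ℂ → ℂ → ℂ} (hF : HasEuler F F₁ F₂) (h1 : F₁ = G₁)
    (h2 : F₂ = G₂) : HasEuler F G₁ G₂ := h1 ▸ h2 ▸ hF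

/-- This allows an identity of functions off the axes to be differentiated, and then differentiated
again. -/
theorem HasEuler.unique {F F₁ F₂ G G₁ G₂ : ℂ → ℂ → ℂ} (hF : HasEuler F F₁ F₂)
    (hG : HasEuler G G₁ G₂) (h : ∀ z w, z ≠ 0 → w ≠ 0 → F z w = G z w) :
    (∀ z w, z ≠ 0 → w ≠ 0 → F₁ z w = G₁ z w) ∧ (∀ z w, z ≠ 0 → w ≠ 0 → F₂ z w = G₂ z w) := by
  refine ⟨fun z w hz hw => ?_, fun z w hz hw => ?_⟩
  · have e : (fun s => F s w) =ᶠ[nhds z] fun s => G s w := by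
      filter_upwards [isOpen_ne.mem_nhds hz] with s hs using h s w hs hw
    have := ((hF z w hz hw).1.congr_of_eventuallyEq e.symm).unique (hG z w hz hw).1
    field_simp at this
    exact this
  · have e : (fun s => F z s) =ᶠ[nhds w] fun s => G z s := by
      filter_upwards [isOpen_ne.mem_nhds hw] with s hs using h z s hz hs
    have := ((hF z w hz hw).2.congr_of_eventuallyEq e.symm).unique (hG z w hz hw).2
    field_simp at this
    exact this

theorem hasEuler_wt (p q : ℤ) :
    HasEuler (wt p q) (fun z w => p * wt p q z w) (fun z w => q * wt p q z w) := by
  intro z w hz hw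
  refine ⟨((hasDerivAt_zpow p z (Or.inl hz)).mul_const (w ^ q)).congr_deriv ?_,
    ((hasDerivAt_zpow q w (Or.inl hw)).const_mul (z ^ p)).congr_deriv ?_⟩
  · rw [zpow_sub_one₀ hz]; simp only [wt]; ring
  · rw [zpow_sub_one₀ hw]; simp only [wt]; ring

/-- The signed orbit sum with an additional coefficient depending on the exponent. -/
def orbSumW (f : ℤ × ℤ → ℂ) (ε δ : ℂ) (p q : ℤ) (z w : ℂ) : ℂ :=
  ∑ i, chi ε δ i * f (orb p q i) * wt (orb p q i).1 (orb p q i).2 z w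

theorem hasEuler_sum {ι : Type*} (s : Finset ι) {F F₁ F₂ : ι → ℂ → ℂ → ℂ}
    (h : ∀ i, HasEuler (F i) (F₁ i) (F₂ i)) :
    HasEuler (∑ i ∈ s, F i) (∑ i ∈ s, F₁ i) (∑ i ∈ s, F₂ i) := by
  classical
  induction s using Finset.induction_on with
  | empty => exact HasEuler.const 0
  | insert i s hi ih => simp only [Finset.sum_insert hi]; exact (h i).add ih

theorem hasEuler_orbSumW (f : ℤ × ℤ → ℂ) (ε δ : ℂ) (p q : ℤ) :
    HasEuler (orbSumW f ε δ p q) (orbSumW (fun v => v.1 * f v) ε δ p q)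
      (orbSumW (fun v => v.2 * f v) ε δ p q) := by
  have key := hasEuler_sum Finset.univ fun i : Fin 12 =>
    (HasEuler.const (chi ε δ i * f (orb p q i))).mul (hasEuler_wt (orb p q i).1 (orb p q i).2)
  have e : ∀ g : ℤ × ℤ → ℂ, orbSumW g ε δ p q = ∑ i, fun z w =>
      chi ε δ i * g (orb p q i) * wt (orb p q i).1 (orb p q i).2 z w := by
    intro g
    ext z w
    simp [orbSumW, Finset.sum_apply]
  simp only [e]
  refine HasEuler.congr key ?_ ?_ <;>
  · refine Finset.sum_congr rfl fun i _ => ?_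
    ext z w
    simp only [Pi.add_apply, Pi.mul_apply, Pi.zero_apply]
    ring

theorem orbSum_eq_orbSumW : orbSum = orbSumW (fun _ => 1) := by
  ext ε δ p q z w
  simp [orbSum, orbSumW]

/-- The form p² - pq + q² is the squared length on the weight lattice, which the Weyl group
preserves. -/
theorem orb_norm (p q : ℤ) (i : Fin 12) :
    (orb p q i).1 ^ 2 - (orb p q i).1 * (orb p q i).2 + (orb p q i).2 ^ 2
      = p ^ 2 - p * q + q ^ 2 := by
  fin_cases i <;> simp [orb] <;> ring

/-- The Laplacian multiplies each monomial by the squared length of its exponent, which is constant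
on the orbit. The factors `* 1` have the literal shape produced by iterating `hasEuler_orbSumW` from
the constant 1. -/
theorem orbSumW_laplace (ε δ : ℂ) (p q : ℤ) (z w : ℂ) :
    orbSumW (fun v => v.1 * (v.1 * 1)) ε δ p q z w - orbSumW (fun v => v.2 * (v.1 * 1)) ε δ p q z w
      + orbSumW (fun v => v.2 * (v.2 * 1)) ε δ p q z w
      = (p ^ 2 - p * q + q ^ 2) * orbSumW (fun _ => 1) ε δ p q z w := by
  simp only [orbSumW, Finset.mul_sum, ← Finset.sum_sub_distrib, ← Finset.sum_add_distrib]
  refine Finset.sum_congr rfl fun i _ => ?_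
  have h : ((orb p q i).1 : ℂ) ^ 2 - (orb p q i).1 * (orb p q i).2 + (orb p q i).2 ^ 2
      = p ^ 2 - p * q + q ^ 2 := by exact_mod_cast orb_norm p q i
  linear_combination chi ε δ i * wt (orb p q i).1 (orb p q i).2 z w * h

theorem lx_eq_orbSumW : lx = fun z w => 1 / 12 * orbSumW (fun _ => 1) 1 1 1 1 z w := by
  ext z w
  rw [lx_eq, ← orbSum_eq_orbSumW, orbSum_eq]
  norm_num
  ring

theorem ly_eq_orbSumW : ly = fun z w => 1 / 12 * orbSumW (fun _ => 1) 1 1 1 2 z w := by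
  ext z w
  rw [ly_eq, ← orbSum_eq_orbSumW, orbSum_eq]
  norm_num
  ring

/-- The Euler derivatives of `x` and `y`: the factor `f` records the order of derivation. -/
def lxW (f : ℤ × ℤ → ℂ) (z w : ℂ) : ℂ := 1 / 12 * orbSumW f 1 1 1 1 z w

/-- The Euler derivatives of `y`, with the same convention. -/
def lyW (f : ℤ × ℤ → ℂ) (z w : ℂ) : ℂ := 1 / 12 * orbSumW f 1 1 1 2 z w

theorem hasEuler_lxW (f : ℤ × ℤ → ℂ) :
    HasEuler (lxW f) (lxW fun v => v.1 * f v) (lxW fun v => v.2 * f v) := by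
  refine ((HasEuler.const (1 / 12)).mul (hasEuler_orbSumW f 1 1 1 1)).congr ?_ ?_ <;>
  · ext z w; simp [lxW]

theorem hasEuler_lyW (f : ℤ × ℤ → ℂ) :
    HasEuler (lyW f) (lyW fun v => v.1 * f v) (lyW fun v => v.2 * f v) := by
  refine ((HasEuler.const (1 / 12)).mul (hasEuler_orbSumW f 1 1 1 2)).congr ?_ ?_ <;>
  · ext z w; simp [lyW]

-- The chain rule for a polynomial in x and y.
open MvPolynomial in
theorem hasEuler_pev (P : MvPolynomial (Fin 2) ℝ) :
    HasEuler (pev P)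
      (pev (pderiv 0 P) * lxW (fun v => v.1 * 1) + pev (pderiv 1 P) * lyW (fun v => v.1 * 1))
      (pev (pderiv 0 P) * lxW (fun v => v.2 * 1) + pev (pderiv 1 P) * lyW (fun v => v.2 * 1)) := by
  induction P using MvPolynomial.induction_on with
  | C a =>
    have e : pev (C a) = fun _ _ => (a : ℂ) := by ext z w; simp [pev]
    have e0 : pev 0 = 0 := by ext z w; simp [pev]
    rw [e]
    refine (HasEuler.const _).congr ?_ ?_ <;> simp [e0]
  | add P R hP hR =>
    have e : ∀ P R, pev (P + R) = pev P + pev R := by intro P R; ext z w; simp [pev]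
    rw [e]
    refine (hP.add hR).congr ?_ ?_ <;> simp only [map_add, e] <;> ring
  | mul_X P i hP =>
    have e : ∀ P R, pev (P * R) = pev P * pev R := by intro P R; ext z w; simp [pev]
    have ea : ∀ P R, pev (P + R) = pev P + pev R := by intro P R; ext z w; simp [pev]
    have e0 : pev 0 = 0 := by ext z w; simp [pev]
    have e1 : pev 1 = 1 := by ext z w; simp [pev]
    have hX : pev (X 0) = lxW fun _ => 1 := by ext z w; simp [pev, lx_eq_orbSumW, lxW]
    have hY : pev (X 1) = lyW fun _ => 1 := by ext z w; simp [pev, ly_eq_orbSumW, lyW]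
    rw [e]
    fin_cases i
    · simp only [Fin.zero_eta, hX, Derivation.leibniz, smul_eq_mul, ea, e, pderiv_X_self,
        pderiv_X_of_ne (show (0 : Fin 2) ≠ 1 by decide), e0, e1]
      refine (hP.mul (hasEuler_lxW _)).congr ?_ ?_ <;> ring
    · simp only [Fin.mk_one, hY, Derivation.leibniz, smul_eq_mul, ea, e, pderiv_X_self,
        pderiv_X_of_ne (show (1 : Fin 2) ≠ 0 by decide), e0, e1]
      refine (hP.mul (hasEuler_lyW _)).congr ?_ ?_ <;> ring

open MvPolynomial in
theorem pderiv_pderiv_comm (P : MvPolynomial (Fin 2) ℝ) :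
    pderiv 1 (pderiv 0 P) = pderiv 0 (pderiv 1 P) := by
  induction P using MvPolynomial.induction_on with
  | C a => simp
  | add P R hP hR => simp [hP, hR]
  | mul_X P i hP =>
    fin_cases i <;>
    · simp [Derivation.leibniz, hP, pderiv_X, add_comm]

theorem wt_eq (p q : ℤ) (z w : ℂ) : wt p q z w = z ^ p * w ^ q := rfl

/-- The Gram matrix of the gradients of x and y for the invariant metric consists of invariant
Laurent polynomials, hence of polynomials in x and y. Scaled by 6 it is -Λ; the minus sign comes
from z∂_z = -i∂_s on the torus. The off-diagonal entry is doubled in `gamma_xy`. -/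
theorem gamma_xx {z w : ℂ} (hz : z ≠ 0) (hw : w ≠ 0) :
    6 * (lxW (fun v => v.1 * 1) z w ^ 2 - lxW (fun v => v.1 * 1) z w * lxW (fun v => v.2 * 1) z w
      + lxW (fun v => v.2 * 1) z w ^ 2)
      = -(-6 * lx z w ^ 2 + ly z w + 3 * lx z w + 2) := by
  simp [lxW, orbSumW, orb, chi, Fin.sum_univ_succ, lx, ly, wt_eq, zpow_ofNat]
  field_simp
  ring

theorem gamma_xy {z w : ℂ} (hz : z ≠ 0) (hw : w ≠ 0) :
    6 * (2 * lxW (fun v => v.1 * 1) z w * lyW (fun v => v.1 * 1) z w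
      - lxW (fun v => v.1 * 1) z w * lyW (fun v => v.2 * 1) z w
      - lxW (fun v => v.2 * 1) z w * lyW (fun v => v.1 * 1) z w
      + 2 * lxW (fun v => v.2 * 1) z w * lyW (fun v => v.2 * 1) z w)
      = -2 * (-9 * lx z w * ly z w + 18 * lx z w ^ 2 - 6 * ly z w - 3) := by
  simp [lxW, lyW, orbSumW, orb, chi, Fin.sum_univ_succ, lx, ly, wt_eq, zpow_ofNat]
  field_simp
  ring

theorem gamma_yy {z w : ℂ} (hz : z ≠ 0) (hw : w ≠ 0) :
    6 * (lyW (fun v => v.1 * 1) z w ^ 2 - lyW (fun v => v.1 * 1) z w * lyW (fun v => v.2 * 1) z w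
      + lyW (fun v => v.2 * 1) z w ^ 2)
      = -(-18 * ly z w ^ 2 + 108 * lx z w ^ 3 - 54 * lx z w * ly z w - 27 * lx z w
        - 9 * ly z w) := by
  simp [lyW, orbSumW, orb, chi, Fin.sum_univ_succ, lx, ly, wt_eq, zpow_ofNat]
  field_simp
  ring

/-- Euler derivatives of `alt r a b`. -/
def altW (f : ℤ × ℤ → ℂ) (r : ℕ × ℕ) (a b : ℤ) (z w : ℂ) : ℂ :=
  orbSumW f ((-1) ^ r.2) ((-1) ^ (r.1 + r.2)) (a + b) (a + 2 * b) z w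

/-- The pairing of the gradient of the denominator with that of x has the same signs under the group
as the denominator, and so is a multiple of it. The quotient is the part of B₁ that depends on r;
`gamma_alt_y` does this for B₂. -/
theorem gamma_alt_x {r : ℕ × ℕ} (h1 : r.1 ≤ 1) (h2 : r.2 ≤ 1) {z w : ℂ} (hz : z ≠ 0) (hw : w ≠ 0) :
    6 * (2 * altW (fun v => v.1 * 1) r r.1 r.2 z w * lxW (fun v => v.1 * 1) z w
      - altW (fun v => v.1 * 1) r r.1 r.2 z w * lxW (fun v => v.2 * 1) z w
      - altW (fun v => v.2 * 1) r r.1 r.2 z w * lxW (fun v => v.1 * 1) z w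
      + 2 * altW (fun v => v.2 * 1) r r.1 r.2 z w * lxW (fun v => v.2 * 1) z w)
      = altW (fun _ => 1) r r.1 r.2 z w * (r.1 * (12 * lx z w + 6) + 18 * r.2 * lx z w) := by
  obtain ⟨_ | _ | r1, _ | _ | r2⟩ := r
  · simp [altW, orbSumW, orb, chi, Fin.sum_univ_succ]
  · simp [altW, lxW, orbSumW, orb, chi, Fin.sum_univ_succ, lx, wt_eq, zpow_ofNat]
    field_simp
    ring
  all_goals first
    | (simp at h1; done)
    | (simp at h2; done)
    | skip
  · simp [altW, lxW, orbSumW, orb, chi, Fin.sum_univ_succ, lx, wt_eq, zpow_ofNat]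
    field_simp
    ring
  · simp [altW, lxW, orbSumW, orb, chi, Fin.sum_univ_succ, lx, wt_eq, zpow_ofNat]
    field_simp
    ring

theorem gamma_alt_y {r : ℕ × ℕ} (h1 : r.1 ≤ 1) (h2 : r.2 ≤ 1) {z w : ℂ} (hz : z ≠ 0) (hw : w ≠ 0) :
    6 * (2 * altW (fun v => v.1 * 1) r r.1 r.2 z w * lyW (fun v => v.1 * 1) z w
      - altW (fun v => v.1 * 1) r r.1 r.2 z w * lyW (fun v => v.2 * 1) z w
      - altW (fun v => v.2 * 1) r r.1 r.2 z w * lyW (fun v => v.1 * 1) z w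
      + 2 * altW (fun v => v.2 * 1) r r.1 r.2 z w * lyW (fun v => v.2 * 1) z w)
      = altW (fun _ => 1) r r.1 r.2 z w *
        (r.1 * (36 * lx z w + 18 * ly z w) + r.2 * (36 * ly z w + 18)) := by
  obtain ⟨_ | _ | r1, _ | _ | r2⟩ := r
  · simp [altW, orbSumW, orb, chi, Fin.sum_univ_succ]
  · simp [altW, lyW, orbSumW, orb, chi, Fin.sum_univ_succ, ly, wt_eq, zpow_ofNat]
    field_simp
    ring
  all_goals first
    | (simp at h1; done)
    | (simp at h2; done)
    | skip
  · simp [altW, lyW, orbSumW, orb, chi, Fin.sum_univ_succ, lx, ly, wt_eq, zpow_ofNat]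
    field_simp
    ring
  · simp [altW, lyW, orbSumW, orb, chi, Fin.sum_univ_succ, lx, ly, wt_eq, zpow_ofNat]
    field_simp
    ring

theorem hasEuler_altW (f : ℤ × ℤ → ℂ) (r : ℕ × ℕ) (a b : ℤ) :
    HasEuler (altW f r a b) (altW (fun v => v.1 * f v) r a b) (altW (fun v => v.2 * f v) r a b) :=
  hasEuler_orbSumW _ _ _ _ _

theorem alt_eq_altW (r : ℕ × ℕ) (a b : ℤ) : alt r a b = altW (fun _ => 1) r a b := by
  ext z w
  rw [alt, orbSum_eq_orbSumW, altW]

theorem altW_laplace (r : ℕ × ℕ) (a b : ℤ) (z w : ℂ) :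
    altW (fun v => v.1 * (v.1 * 1)) r a b z w - altW (fun v => v.2 * (v.1 * 1)) r a b z w
      + altW (fun v => v.2 * (v.2 * 1)) r a b z w
      = (a ^ 2 + 3 * a * b + 3 * b ^ 2) * altW (fun _ => 1) r a b z w := by
  rw [altW, altW, altW, orbSumW_laplace, altW]
  push_cast
  ring

theorem lxW_laplace (z w : ℂ) :
    lxW (fun v => v.1 * (v.1 * 1)) z w - lxW (fun v => v.2 * (v.1 * 1)) z w
      + lxW (fun v => v.2 * (v.2 * 1)) z w = lx z w := by
  have := orbSumW_laplace 1 1 1 1 z w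
  rw [lx_eq_orbSumW]
  simp only [lxW]
  push_cast at this
  linear_combination this / 12

theorem lyW_laplace (z w : ℂ) :
    lyW (fun v => v.1 * (v.1 * 1)) z w - lyW (fun v => v.2 * (v.1 * 1)) z w
      + lyW (fun v => v.2 * (v.2 * 1)) z w = 3 * ly z w := by
  have := orbSumW_laplace 1 1 1 2 z w
  rw [ly_eq_orbSumW]
  simp only [lyW]
  push_cast at this
  linear_combination this / 12

open MvPolynomial in
theorem pev_opL (α β : ℝ) (P : MvPolynomial (Fin 2) ℝ) (z w : ℂ) :
    pev (opL α β P) z w =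
    -(-6 * lx z w ^ 2 + ly z w + 3 * lx z w + 2) * pev (pderiv 0 (pderiv 0 P)) z w
    - 2 * (-9 * lx z w * ly z w + 18 * lx z w ^ 2 - 6 * ly z w - 3)
      * pev (pderiv 0 (pderiv 1 P)) z w
    - (-18 * ly z w ^ 2 + 108 * lx z w ^ 3 - 54 * lx z w * ly z w - 27 * lx z w - 9 * ly z w)
      * pev (pderiv 1 (pderiv 1 P)) z w
    + ((21 + 12 * α + 18 * β) * lx z w + (6 * α + 3)) * pev (pderiv 0 P) z w
    + ((18 + 36 * α) * lx z w + (45 + 36 * β + 18 * α) * ly z w + (18 * β + 9))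
      * pev (pderiv 1 P) z w := by
  simp [pev, opL, A₁₁, A₁₂, A₂₂]

-- Conjugation of the Laplacian by the denominator ω: 6D(Qω) - 6Q·Dω equals ω times the operator
-- applied to Q, while Qω and ω are both eigenfunctions of D. The eigenvalue is the difference 6(N(k
-- + r) - N(r)).
open MvPolynomial in
theorem pev_opL_mul_alt {r k : ℕ × ℕ} (h1 : r.1 ≤ 1) (h2 : r.2 ≤ 1)
    {Q : MvPolynomial (Fin 2) ℝ} (hQ : IsRep r k Q) {z w : ℂ} (hz : z ≠ 0) (hw : w ≠ 0) :
    pev (opL (r.1 - 1 / 2) (r.2 - 1 / 2) Q) z w * alt r r.1 r.2 z w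
      = eigval (r.1 - 1 / 2) (r.2 - 1 / 2) k * (pev Q z w * alt r r.1 r.2 z w) := by
  have hM := hasEuler_altW (fun _ => 1) r (k.1 + r.1) (k.2 + r.2)
  have hF := (hasEuler_pev Q).mul (hasEuler_altW (fun _ => 1) r r.1 r.2)
  have hFM : ∀ z w, z ≠ 0 → w ≠ 0 → (pev Q * altW (fun _ => 1) r r.1 r.2) z w
      = altW (fun _ => 1) r (k.1 + r.1) (k.2 + r.2) z w := by
    intro z w hz hw
    rw [← alt_eq_altW, ← alt_eq_altW]
    exact hQ z w hz hw
  obtain ⟨e1, e2⟩ := hF.unique hM hFM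
  have hx1 := hasEuler_lxW (fun v => v.1 * 1)
  have hx2 := hasEuler_lxW (fun v => v.2 * 1)
  have hy1 := hasEuler_lyW (fun v => v.1 * 1)
  have hy2 := hasEuler_lyW (fun v => v.2 * 1)
  have hP0 := hasEuler_pev (pderiv 0 Q)
  have hP1 := hasEuler_pev (pderiv 1 Q)
  have hF1 := ((((hP0.mul hx1).add (hP1.mul hy1)).mul (hasEuler_altW (fun _ => 1) r r.1 r.2)).add
    ((hasEuler_pev Q).mul (hasEuler_altW (fun v => v.1 * 1) r r.1 r.2)))
  have hF2 := ((((hP0.mul hx2).add (hP1.mul hy2)).mul (hasEuler_altW (fun _ => 1) r r.1 r.2)).add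
    ((hasEuler_pev Q).mul (hasEuler_altW (fun v => v.2 * 1) r r.1 r.2)))
  obtain ⟨e11, e12⟩ := hF1.unique (hasEuler_altW (fun v => v.1 * 1) r _ _) e1
  obtain ⟨-, e22⟩ := hF2.unique (hasEuler_altW (fun v => v.2 * 1) r _ _) e2
  have e11 := e11 z w hz hw
  have e12 := e12 z w hz hw
  have e22 := e22 z w hz hw
  have e0 := hFM z w hz hw
  have g1 := gamma_xx hz hw
  have g2 := gamma_xy hz hw
  have g3 := gamma_yy hz hw
  have g4 := gamma_alt_x h1 h2 hz hw
  have g5 := gamma_alt_y h1 h2 hz hw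
  have l1 := altW_laplace r r.1 r.2 z w
  have l2 := altW_laplace r (k.1 + r.1) (k.2 + r.2) z w
  have l3 := lxW_laplace z w
  have l4 := lyW_laplace z w
  rw [pev_opL, alt_eq_altW]
  simp only [Pi.add_apply, Pi.mul_apply, pderiv_pderiv_comm] at e11 e12 e22 e0
  rw [← e11, ← e12, ← e22, ← e0] at l2
  simp only [eigval, mDeg]
  push_cast at *
  set ω := altW (fun _ => 1) r r.1 r.2 z w
  -- Starting from six times the eigenvalue equation of Qω, `l1`, `l3`, `l4` evaluate the Laplacians
  -- of ω, x, y; `g1`, `g2`, `g3` give the second-order coefficients, and `g4`, `g5` the cross terms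
  -- with ω.
  linear_combination 6 * l2 - 6 * pev Q z w * l1 - ω * pev (pderiv 0 (pderiv 0 Q)) z w * g1
    - ω * pev (pderiv 0 (pderiv 1 Q)) z w * g2 - ω * pev (pderiv 1 (pderiv 1 Q)) z w * g3
    - pev (pderiv 0 Q) z w * g4 - pev (pderiv 1 Q) z w * g5
    - 6 * ω * pev (pderiv 0 Q) z w * l3 - 6 * ω * pev (pderiv 1 Q) z w * l4

/-! ### The unit torus and the Chebyshev condition -/

/-- The point `exp (i s)` of the unit circle. -/
def cis (s : ℝ) : ℂ := Complex.exp (s * Complex.I)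

theorem cis_ne_zero (s : ℝ) : cis s ≠ 0 := Complex.exp_ne_zero _

theorem cis_zpow (s : ℝ) (n : ℤ) : cis s ^ n = cis (n * s) := by
  rw [cis, cis, ← Complex.exp_int_mul]; push_cast; ring_nf

theorem cis_mul (s t : ℝ) : cis s * cis t = cis (s + t) := by
  rw [cis, cis, cis, ← Complex.exp_add]; push_cast; ring_nf

theorem wt_cis (p q : ℤ) (s t : ℝ) : wt p q (cis s) (cis t) = cis (p * s + q * t) := by
  rw [wt, cis_zpow, cis_zpow, cis_mul]

theorem cis_eq (s : ℝ) : cis s = Real.cos s + Real.sin s * Complex.I := by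
  rw [cis, Complex.exp_mul_I, Complex.ofReal_cos, Complex.ofReal_sin]

/-- The map to the variables `(x, y)` in angular coordinates. -/
def chart (p : ℝ × ℝ) : ℝ × ℝ :=
  ((Real.cos p.1 + Real.cos p.2 + Real.cos (p.1 + p.2)) / 3,
    (Real.cos (p.1 - p.2) + Real.cos (2 * p.1 + p.2) + Real.cos (p.1 + 2 * p.2)) / 3)

theorem wt_add_wt_neg (p q : ℤ) (s t : ℝ) :
    wt p q (cis s) (cis t) + wt (-p) (-q) (cis s) (cis t) = 2 * (Real.cos (p * s + q * t) : ℝ) := by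
  have h : ((-p : ℤ) : ℝ) * s + ((-q : ℤ) : ℝ) * t = -(p * s + q * t) := by push_cast; ring
  rw [wt_cis, wt_cis, h, cis_eq, cis_eq, Real.cos_neg, Real.sin_neg]
  push_cast
  ring

theorem lx_cis (p : ℝ × ℝ) : lx (cis p.1) (cis p.2) = (chart p).1 := by
  have a := wt_add_wt_neg 1 0 p.1 p.2
  have b := wt_add_wt_neg 0 1 p.1 p.2
  have c := wt_add_wt_neg 1 1 p.1 p.2
  simp only [Int.cast_one, Int.cast_zero, one_mul, zero_mul, add_zero, zero_add, neg_zero] at a b c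
  rw [lx_eq, chart]
  push_cast at *
  linear_combination (a + b + c) / 6

theorem ly_cis (p : ℝ × ℝ) : ly (cis p.1) (cis p.2) = (chart p).2 := by
  have a := wt_add_wt_neg 1 (-1) p.1 p.2
  have b := wt_add_wt_neg 2 1 p.1 p.2
  have c := wt_add_wt_neg 1 2 p.1 p.2
  push_cast at a b c
  simp only [one_mul, neg_mul, ← sub_eq_add_neg] at a b c
  rw [ly_eq, chart]
  push_cast
  linear_combination (a + b + c) / 6

theorem pev_cis (Q : MvPolynomial (Fin 2) ℝ) (p : ℝ × ℝ) :
    pev Q (cis p.1) (cis p.2) = evalAt Q (chart p) := by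
  have : (![lx (cis p.1) (cis p.2), ly (cis p.1) (cis p.2)] : Fin 2 → ℂ)
      = fun i => algebraMap ℝ ℂ (![(chart p).1, (chart p).2] i) := by
    ext i; fin_cases i <;> simp [lx_cis, ly_cis]
  rw [pev, this, evalAt, ← MvPolynomial.aeval_eq_eval]
  exact MvPolynomial.aeval_algebraMap_apply ℂ _ Q

/-- The fundamental triangle in angular coordinates. -/
def tri : Set (ℝ × ℝ) := {p | 0 ≤ p.1 ∧ p.1 ≤ p.2 ∧ p.1 + 2 * p.2 ≤ 2 * Real.pi}

/-- The angular coordinates of a point in homogeneous coordinates. -/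
def angles (t : Fin 3 → ℝ) : ℝ × ℝ :=
  (2 * Real.pi / 3 * (t 0 - t 1), 2 * Real.pi / 3 * (t 1 - t 2))

/-- Summation by parts on the plane of sum zero: k·t = k₁(t₁ - t₂) + (k₁ + k₂)(t₂ - t₃), with
indices starting at 1. -/
theorem phi_eq {k : Fin 3 → ℤ} {t : Fin 3 → ℝ} (hk : k 0 + k 1 + k 2 = 0)
    (ht : t 0 + t 1 + t 2 = 0) :
    phi k t = wt (k 0) (k 0 + k 1) (cis (angles t).1) (cis (angles t).2) := by
  rw [wt_cis, phi, cis, angles, Fin.sum_univ_three]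
  have e2 : t 2 = -t 0 - t 1 := by linarith
  have e3 : k 2 = -k 0 - k 1 := by linarith
  rw [e2, e3]
  congr 1
  push_cast
  ring

theorem sumA2_eq (ε δ : ℂ) {k : Fin 3 → ℤ} {t : Fin 3 → ℝ} (hk : k 0 + k 1 + k 2 = 0)
    (ht : t 0 + t 1 + t 2 = 0) :
    sumA2 ε (fun j => phi j t + δ * phi (-j) t) k
      = orbSum ε δ (k 0) (k 0 + k 1) (cis (angles t).1) (cis (angles t).2) := by
  have h : ∀ j : Fin 3 → ℤ, j 0 + j 1 + j 2 = 0 → phi j t + δ * phi (-j) t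
      = wt (j 0) (j 0 + j 1) (cis (angles t).1) (cis (angles t).2)
        + δ * wt (-j 0) (-j 0 - j 1) (cis (angles t).1) (cis (angles t).2) := by
    intro j hj
    rw [phi_eq hj ht, phi_eq (by simp only [Pi.neg_apply]; linarith) ht]
    simp only [Pi.neg_apply, ← sub_eq_add_neg]
  have e3 : k 2 = -k 0 - k 1 := by linarith
  rw [sumA2, h k hk, h, h, h, h, h, orbSum_eq]
  · simp only [Matrix.cons_val_zero, Matrix.cons_val_one, e3]
    ring_nf
  all_goals
    simp [Matrix.cons_val]
    linarith

theorem CC_eq {k : Fin 3 → ℤ} {t : Fin 3 → ℝ} (hk : k 0 + k 1 + k 2 = 0)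
    (ht : t 0 + t 1 + t 2 = 0) :
    CC k t = 1 / 12 * orbSum 1 1 (k 0) (k 0 + k 1) (cis (angles t).1) (cis (angles t).2) := by
  rw [← sumA2_eq 1 1 hk ht, CC]; simp only [one_mul]

theorem SC_eq {k : Fin 3 → ℤ} {t : Fin 3 → ℝ} (hk : k 0 + k 1 + k 2 = 0)
    (ht : t 0 + t 1 + t 2 = 0) : SC k t = 1 / (12 * Complex.I) *
      orbSum 1 (-1) (k 0) (k 0 + k 1) (cis (angles t).1) (cis (angles t).2) := by
  rw [← sumA2_eq 1 (-1) hk ht, SC]; simp only [neg_mul, one_mul, ← sub_eq_add_neg]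

theorem CS_eq {k : Fin 3 → ℤ} {t : Fin 3 → ℝ} (hk : k 0 + k 1 + k 2 = 0)
    (ht : t 0 + t 1 + t 2 = 0) : CS k t = 1 / (12 * Complex.I) *
      orbSum (-1) (-1) (k 0) (k 0 + k 1) (cis (angles t).1) (cis (angles t).2) := by
  rw [← sumA2_eq (-1) (-1) hk ht, CS]; simp only [neg_mul, one_mul, ← sub_eq_add_neg]

theorem SS_eq {k : Fin 3 → ℤ} {t : Fin 3 → ℝ} (hk : k 0 + k 1 + k 2 = 0)
    (ht : t 0 + t 1 + t 2 = 0) : SS k t = -(1 / 12) *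
      orbSum (-1) 1 (k 0) (k 0 + k 1) (cis (angles t).1) (cis (angles t).2) := by
  rw [← sumA2_eq (-1) 1 hk ht, SS]; simp only [one_mul]

theorem coords_eq_chart {t : Fin 3 → ℝ} (ht : t 0 + t 1 + t 2 = 0) :
    (xCoord t, yCoord t) = chart (angles t) := by
  have hx : CC ![1, 0, -1] t = ((chart (angles t)).1 : ℂ) := by
    rw [CC_eq (by simp) ht, ← lx_cis, lx_eq_orbSumW, orbSum_eq_orbSumW]; simp
  have hy : CC ![1, 1, -2] t = ((chart (angles t)).2 : ℂ) := by
    rw [CC_eq (by simp [Matrix.cons_val]) ht, ← ly_cis, ly_eq_orbSumW, orbSum_eq_orbSumW]; simp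
  rw [xCoord, yCoord, hx, hy, Complex.ofReal_re, Complex.ofReal_re]

theorem angles_mem_tri {t : Fin 3 → ℝ} (ht : t ∈ triangle) : angles t ∈ tri := by
  obtain ⟨h0, h1, h2, h3, h4⟩ := ht
  have hpi := Real.pi_pos
  refine ⟨?_, ?_, ?_⟩ <;> simp only [angles]
  · exact mul_nonneg (by positivity) (by linarith)
  · exact mul_le_mul_of_nonneg_left (by linarith) (by positivity)
  · have : 2 * Real.pi / 3 * (t 0 - t 1) + 2 * (2 * Real.pi / 3 * (t 1 - t 2))
      = 2 * Real.pi * -t 2 := by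
      rw [show t 0 = -t 1 - t 2 by linarith]; ring
    rw [this]
    nlinarith

theorem exists_angles_eq {p : ℝ × ℝ} (hp : p ∈ tri) : ∃ t ∈ triangle, angles t = p := by
  obtain ⟨h1, h2, h3⟩ := hp
  have hpi := Real.pi_pos
  refine ⟨![(2 * p.1 + p.2) / (2 * Real.pi), (p.2 - p.1) / (2 * Real.pi),
    -(p.1 + 2 * p.2) / (2 * Real.pi)], ⟨?_, ?_, ?_, ?_, ?_⟩, ?_⟩
  · simp only [Matrix.cons_val]; ring
  · simp only [Matrix.cons_val]; exact div_nonneg (by linarith) (by positivity)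
  · simp only [Matrix.cons_val]; gcongr ?_ / _; linarith
  · simp only [Matrix.cons_val]; rw [neg_div, neg_neg]; gcongr ?_ / _; linarith
  · simp only [Matrix.cons_val]; rw [neg_div, neg_neg, div_le_one (by positivity)]; linarith
  · ext <;> simp only [angles, Matrix.cons_val] <;> field_simp <;> ring

theorem deltaStar_eq : deltaStar = chart '' tri := by
  ext p
  constructor
  · rintro ⟨t, ht, rfl⟩
    exact ⟨angles t, angles_mem_tri ht, (coords_eq_chart ht.1).symm⟩
  · rintro ⟨q, hq, rfl⟩
    obtain ⟨t, ht, rfl⟩ := exists_angles_eq hq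
    exact ⟨t, ht, coords_eq_chart ht.1⟩

/-- `alt r` on the unit torus. -/
def altT (r : ℕ × ℕ) (a b : ℤ) (p : ℝ × ℝ) : ℂ := alt r a b (cis p.1) (cis p.2)

theorem altT_zero (p : ℝ × ℝ) : altT (0, 0) 0 0 p = 12 := by
  simp [altT, alt, orbSum_eq, wt]; norm_num

/-- All four families in one formula. The prefactors 1/12, 1/(12i) and -1/12 cancel in the
quotients; for r = (0, 0) the denominator is the constant 12, which absorbs the prefactor of CC. -/
theorem isChebyshev_iff {r : ℕ × ℕ} (h1 : r.1 ≤ 1) (h2 : r.2 ≤ 1) (k : ℕ × ℕ)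
    (Q : MvPolynomial (Fin 2) ℝ) :
    IsChebyshev (r.1 - 1 / 2) (r.2 - 1 / 2) k.1 k.2 Q ↔ ∀ p ∈ tri, altT r r.1 r.2 p ≠ 0 →
      evalAt Q (chart p) * altT r r.1 r.2 p = altT r (k.1 + r.1) (k.2 + r.2) p := by
  have key : IsChebyshev (r.1 - 1 / 2) (r.2 - 1 / 2) k.1 k.2 Q ↔
      ∀ t ∈ triangle, altT r r.1 r.2 (angles t) ≠ 0 →
        evalAt Q (chart (angles t)) * altT r r.1 r.2 (angles t)
          = altT r (k.1 + r.1) (k.2 + r.2) (angles t) := by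
    refine forall₂_congr fun t ht => ?_
    have ht := ht.1
    rw [coords_eq_chart ht]
    have hI := Complex.I_ne_zero
    obtain ⟨_ | _ | r1, _ | _ | r2⟩ := r
    · rw [CC_eq (by simp [Matrix.cons_val]; ring) ht]
      simp only [Nat.cast_zero, altT_zero, Matrix.cons_val]
      norm_num
      rw [altT, alt]
      norm_num
      rw [show (k.1 : ℤ) + k.2 + k.2 = k.1 + 2 * k.2 by ring]
      constructor <;> intro h
      · rw [h]; ring
      · rw [← h]; ring
    · rw [CS_eq (by simp [Matrix.cons_val]) ht, CS_eq (by simp [Matrix.cons_val]; ring) ht]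
      norm_num [altT, alt, Matrix.cons_val]
      rw [show (k.1 : ℤ) + k.2 + 1 + (k.2 + 1) = k.1 + 2 * (k.2 + 1) by ring,
        show (k.1 : ℤ) + k.2 + 1 = k.1 + (k.2 + 1) by ring]
      refine forall_congr' fun h0 => ?_
      field_simp
    · simp at h2
    · rw [SC_eq (by simp [Matrix.cons_val]) ht, SC_eq (by simp [Matrix.cons_val]; ring) ht]
      norm_num [altT, alt, Matrix.cons_val]
      rw [show (k.1 : ℤ) + k.2 + 1 + k.2 = k.1 + 1 + 2 * k.2 by ring,
        show (k.1 : ℤ) + k.2 + 1 = k.1 + 1 + k.2 by ring]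
      refine forall_congr' fun h0 => ?_
      field_simp
    · rw [SS_eq (by simp [Matrix.cons_val]) ht, SS_eq (by simp [Matrix.cons_val]; ring) ht]
      norm_num [altT, alt, Matrix.cons_val]
      rw [show (k.1 : ℤ) + k.2 + 2 + (k.2 + 1) = k.1 + 1 + 2 * (k.2 + 1) by ring,
        show (k.1 : ℤ) + k.2 + 2 = k.1 + 1 + (k.2 + 1) by ring]
      refine forall_congr' fun h0 => ?_
      field_simp
    · simp at h2
    all_goals simp at h1
  rw [key]
  refine ⟨fun h p hp => ?_, fun h t ht => h _ (angles_mem_tri ht)⟩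
  obtain ⟨t, ht, rfl⟩ := exists_angles_eq hp
  exact h t ht

/-! ### Weight, Jacobian and injectivity of the chart -/

/-- The antisymmetric factor vanishing on the walls of the short reflections. -/
def sinOne (p : ℝ × ℝ) : ℝ := Real.sin (p.1 + p.2) - Real.sin p.1 - Real.sin p.2

/-- The antisymmetric factor vanishing on the walls of the long reflections. -/
def sinTwo (p : ℝ × ℝ) : ℝ :=
  Real.sin (p.1 + 2 * p.2) + Real.sin (p.1 - p.2) - Real.sin (2 * p.1 + p.2)

/-- The first factor of the weight. -/
def facOne (p : ℝ × ℝ) : ℝ := 1 + 2 * p.2 - 3 * p.1 ^ 2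

/-- The second factor of the weight. -/
def facTwo (p : ℝ × ℝ) : ℝ :=
  24 * p.1 ^ 3 - p.2 ^ 2 - 12 * p.1 * p.2 - 6 * p.1 - 4 * p.2 - 1

theorem facOne_chart (p : ℝ × ℝ) : facOne (chart p) = sinOne p ^ 2 / 3 := by
  obtain ⟨A, B⟩ := p
  simp only [facOne, chart, sinOne, two_mul, Real.cos_add, Real.cos_sub, Real.sin_add]
  have a := Real.sin_sq_add_cos_sq A
  have b := Real.sin_sq_add_cos_sq B
  generalize Real.sin A = sa at *
  generalize Real.sin B = sb at *
  generalize Real.cos A = ca at *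
  generalize Real.cos B = cb at *
  grind

theorem facTwo_chart (p : ℝ × ℝ) : facTwo (chart p) = sinTwo p ^ 2 / 9 := by
  obtain ⟨A, B⟩ := p
  simp only [facTwo, chart, sinTwo, two_mul, Real.cos_add, Real.cos_sub, Real.sin_add,
    Real.sin_sub]
  have a := Real.sin_sq_add_cos_sq A
  have b := Real.sin_sq_add_cos_sq B
  generalize Real.sin A = sa at *
  generalize Real.sin B = sb at *
  generalize Real.cos A = ca at *
  generalize Real.cos B = cb at *
  grind

/-- The derivative of `chart`. -/
def chartDeriv (p : ℝ × ℝ) : ℝ × ℝ →L[ℝ] ℝ × ℝ :=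
  (Matrix.toLin (.finTwoProd ℝ) (.finTwoProd ℝ)
    !![-(Real.sin p.1 + Real.sin (p.1 + p.2)) / 3, -(Real.sin p.2 + Real.sin (p.1 + p.2)) / 3;
      -(Real.sin (p.1 - p.2) + 2 * Real.sin (2 * p.1 + p.2) + Real.sin (p.1 + 2 * p.2)) / 3,
      -(-Real.sin (p.1 - p.2) + Real.sin (2 * p.1 + p.2) + 2 * Real.sin (p.1 + 2 * p.2)) / 3]
    ).toContinuousLinearMap

theorem hasFDerivAt_chart (p : ℝ × ℝ) : HasFDerivAt chart (chartDeriv p) p := by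
  unfold chartDeriv
  rw [Matrix.toLin_finTwoProd_toContinuousLinearMap]
  have h1 : HasFDerivAt (fun q : ℝ × ℝ => q.1) (ContinuousLinearMap.fst ℝ ℝ ℝ) p := hasFDerivAt_fst
  have h2 : HasFDerivAt (fun q : ℝ × ℝ => q.2) (ContinuousLinearMap.snd ℝ ℝ ℝ) p := hasFDerivAt_snd
  refine HasFDerivAt.prodMk
    ((((h1.cos.add h2.cos).add (h1.add h2).cos).mul_const (3 : ℝ)⁻¹).congr_fderiv ?_)
    (((((h1.sub h2).cos.add ((h1.const_mul 2).add h2).cos).add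
      (h1.add (h2.const_mul 2)).cos).mul_const (3 : ℝ)⁻¹).congr_fderiv ?_)
  · ext <;> simp <;> ring
  · ext <;> simp <;> ring

/-- The Jacobian changes sign under every reflection, so it is a multiple of the product of the two
antisymmetric factors whose squares are the bases of the weight. -/
theorem det_chartDeriv (p : ℝ × ℝ) : (chartDeriv p).det = sinOne p * sinTwo p / 9 := by
  obtain ⟨A, B⟩ := p
  simp only [chartDeriv, LinearMap.det_toContinuousLinearMap, LinearMap.det_toLin,
    Matrix.det_fin_two_of, sinOne, sinTwo, two_mul, Real.cos_add, Real.sin_add, Real.sin_sub]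
  have a := Real.sin_sq_add_cos_sq A
  have b := Real.sin_sq_add_cos_sq B
  generalize Real.sin A = sa at *
  generalize Real.sin B = sb at *
  generalize Real.cos A = ca at *
  generalize Real.cos B = cb at *
  grind

/-- Both triples are the roots of one monic cubic; the largest and the smallest roots are compared,
and the sum fixes the middle one. -/
theorem sorted_triple_unique {a b c a' b' c' : ℝ} (h1 : b ≤ a) (h2 : c ≤ b) (h1' : b' ≤ a')
    (h2' : c' ≤ b') (e1 : a + b + c = a' + b' + c')
    (e2 : a * b + b * c + a * c = a' * b' + b' * c' + a' * c') (e3 : a * b * c = a' * b' * c') :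
    a = a' ∧ b = b' := by
  have ha : (a - a') * (a - b') * (a - c') = 0 := by
    linear_combination a ^ 2 * e1 - a * e2 + e3
  have ha' : (a' - a) * (a' - b) * (a' - c) = 0 := by
    linear_combination -a' ^ 2 * e1 + a' * e2 - e3
  have hc : (c - a') * (c - b') * (c - c') = 0 := by
    linear_combination c ^ 2 * e1 - c * e2 + e3
  have hc' : (c' - a) * (c' - b) * (c' - c) = 0 := by
    linear_combination -c' ^ 2 * e1 + c' * e2 - e3
  simp only [mul_eq_zero, sub_eq_zero] at ha ha' hc hc'
  have haa : a = a' := le_antisymm (by rcases ha with (h | h) | h <;> linarith)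
    (by rcases ha' with (h | h) | h <;> linarith)
  have hcc : c = c' := le_antisymm (by rcases hc' with (h | h) | h <;> linarith)
    (by rcases hc with (h | h) | h <;> linarith)
  exact ⟨haa, by linarith⟩

/-- The pair (x, y) determines the elementary symmetric functions of cos A, cos B, cos(A + B). On
the triangle these cosines are sorted and A, B lie in [0, π], so the cosines and then the angles are
recovered. -/
theorem injOn_chart : Set.InjOn chart tri := by
  rintro ⟨A, B⟩ ⟨h1, h2, h3⟩ ⟨A', B'⟩ ⟨h1', h2', h3'⟩ h
  simp only at h1 h2 h3 h1' h2' h3'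
  obtain ⟨hx, hy⟩ := Prod.ext_iff.1 h
  simp only [chart] at hx hy
  -- The second symmetric function is 3(x + y)/2. The third follows from cos²A + cos²B + cos²C = 1 +
  -- 2 cos A cos B cos C for C = A + B.
  have key : ∀ A B : ℝ, Real.cos A * Real.cos B + Real.cos B * Real.cos (A + B)
      + Real.cos A * Real.cos (A + B) = 3 / 2 *
      ((Real.cos A + Real.cos B + Real.cos (A + B)) / 3 +
      (Real.cos (A - B) + Real.cos (2 * A + B) + Real.cos (A + 2 * B)) / 3) ∧
      Real.cos A * Real.cos B * Real.cos (A + B) = ((Real.cos A + Real.cos B + Real.cos (A + B)) ^ 2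
        - 2 * (Real.cos A * Real.cos B + Real.cos B * Real.cos (A + B)
      + Real.cos A * Real.cos (A + B)) - 1) / 2 := by
    intro A B
    simp only [two_mul, Real.cos_add, Real.cos_sub, Real.sin_add]
    have a := Real.sin_sq_add_cos_sq A
    have b := Real.sin_sq_add_cos_sq B
    generalize Real.sin A = sa at *
    generalize Real.sin B = sb at *
    generalize Real.cos A = ca at *
    generalize Real.cos B = cb at *
    constructor <;> grind
  have sorted : ∀ A B : ℝ, 0 ≤ A → A ≤ B → A + 2 * B ≤ 2 * Real.pi →
      Real.cos B ≤ Real.cos A ∧ Real.cos (A + B) ≤ Real.cos B := by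
    intro A B h1 h2 h3
    refine ⟨Real.cos_le_cos_of_nonneg_of_le_pi h1 (by linarith) h2, ?_⟩
    rcases le_total (A + B) Real.pi with h | h
    · exact Real.cos_le_cos_of_nonneg_of_le_pi (by linarith) h (by linarith)
    · rw [← Real.cos_two_pi_sub (A + B)]
      exact Real.cos_le_cos_of_nonneg_of_le_pi (by linarith) (by linarith) (by linarith)
  obtain ⟨k2, k3⟩ := key A B
  obtain ⟨k2', k3'⟩ := key A' B'
  obtain ⟨s1, s2⟩ := sorted A B h1 h2 h3
  obtain ⟨s1', s2'⟩ := sorted A' B' h1' h2' h3'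
  have e2 : Real.cos A * Real.cos B + Real.cos B * Real.cos (A + B)
      + Real.cos A * Real.cos (A + B) = Real.cos A' * Real.cos B' + Real.cos B' * Real.cos (A' + B')
      + Real.cos A' * Real.cos (A' + B') := by rw [k2, k2', hx, hy]
  have e1 : Real.cos A + Real.cos B + Real.cos (A + B)
      = Real.cos A' + Real.cos B' + Real.cos (A' + B') := by linarith
  have e3 : Real.cos A * Real.cos B * Real.cos (A + B)
      = Real.cos A' * Real.cos B' * Real.cos (A' + B') := by rw [k3, k3', e2, e1]
  obtain ⟨ea, eb⟩ := sorted_triple_unique s1 s2 s1' s2' e1 e2 e3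
  have hA := Real.injOn_cos ⟨h1, by linarith⟩ ⟨h1', by linarith⟩ ea
  have hB := Real.injOn_cos ⟨by linarith, by linarith⟩ ⟨by linarith, by linarith⟩ eb
  rw [hA, hB]

/-- The product form displays the zeros: all three half angles lie strictly between 0 and π in the
open triangle. The factor `sinTwo` is the same expression at (2A + B, B - A). -/
theorem sin_add_sub_sub (A B : ℝ) : Real.sin (A + B) - Real.sin A - Real.sin B
    = -4 * Real.sin (A / 2) * Real.sin (B / 2) * Real.sin ((A + B) / 2) := by
  obtain ⟨a, rfl⟩ : ∃ a, A = 2 * a := ⟨A / 2, by ring⟩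
  obtain ⟨b, rfl⟩ : ∃ b, B = 2 * b := ⟨B / 2, by ring⟩
  rw [← mul_add, mul_div_cancel_left₀ _ two_ne_zero, mul_div_cancel_left₀ _ two_ne_zero,
    mul_div_cancel_left₀ _ two_ne_zero]
  simp only [two_mul, Real.sin_add, Real.cos_add]
  have ha := Real.sin_sq_add_cos_sq a
  have hb := Real.sin_sq_add_cos_sq b
  generalize Real.sin a = sa at *
  generalize Real.sin b = sb at *
  generalize Real.cos a = ca at *
  generalize Real.cos b = cb at *
  grind

/-- The interior of the fundamental triangle in angular coordinates. -/
def triInt : Set (ℝ × ℝ) := {p | 0 < p.1 ∧ p.1 < p.2 ∧ p.1 + 2 * p.2 < 2 * Real.pi}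

theorem triInt_subset : triInt ⊆ tri := fun _ h => ⟨h.1.le, h.2.1.le, h.2.2.le⟩

theorem sinOne_ne_zero {p : ℝ × ℝ} (hp : p ∈ triInt) : sinOne p ≠ 0 := by
  obtain ⟨h1, h2, h3⟩ := hp
  rw [sinOne, sin_add_sub_sub]
  have := Real.sin_pos_of_pos_of_lt_pi (x := p.1 / 2) (by linarith) (by linarith)
  have := Real.sin_pos_of_pos_of_lt_pi (x := p.2 / 2) (by linarith) (by linarith)
  have := Real.sin_pos_of_pos_of_lt_pi (x := (p.1 + p.2) / 2) (by linarith) (by linarith)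
  simp only [neg_mul, neg_ne_zero]
  positivity

theorem sinTwo_ne_zero {p : ℝ × ℝ} (hp : p ∈ triInt) : sinTwo p ≠ 0 := by
  obtain ⟨h1, h2, h3⟩ := hp
  have e := sin_add_sub_sub (2 * p.1 + p.2) (p.2 - p.1)
  rw [show 2 * p.1 + p.2 + (p.2 - p.1) = p.1 + 2 * p.2 by ring] at e
  have e' : sinTwo p = Real.sin (p.1 + 2 * p.2) - Real.sin (2 * p.1 + p.2)
      - Real.sin (p.2 - p.1) := by
    rw [sinTwo, ← neg_sub p.2 p.1, Real.sin_neg]; ring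
  rw [e', e]
  have := Real.sin_pos_of_pos_of_lt_pi (x := (2 * p.1 + p.2) / 2) (by linarith) (by linarith)
  have := Real.sin_pos_of_pos_of_lt_pi (x := (p.2 - p.1) / 2) (by linarith) (by linarith)
  have := Real.sin_pos_of_pos_of_lt_pi (x := (p.1 + 2 * p.2) / 2) (by linarith) (by linarith)
  simp only [neg_mul, neg_ne_zero]
  positivity

/-! ### Unfolding the torus into twelve triangles -/

theorem volume_line (a b c : ℝ) (h : a ≠ 0 ∨ b ≠ 0) :
    volume {p : ℝ × ℝ | a * p.1 + b * p.2 = c} = 0 := by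
  have hab : a ^ 2 + b ^ 2 ≠ 0 := by rcases h with h | h <;> positivity
  let L : ℝ × ℝ →ₗ[ℝ] ℝ := a • LinearMap.fst ℝ ℝ ℝ + b • LinearMap.snd ℝ ℝ ℝ
  have hL : ∀ p, L p = a * p.1 + b * p.2 := fun p => by simp [L]
  have hker : volume (LinearMap.ker L : Set (ℝ × ℝ)) = 0 := by
    apply Measure.addHaar_submodule
    rw [Ne, LinearMap.ker_eq_top]
    intro h0
    apply hab
    have := hL (a, b)
    rw [h0] at this
    simp only [LinearMap.zero_apply] at this
    linear_combination -this
  have e : {p : ℝ × ℝ | a * p.1 + b * p.2 = c} = (fun p => p + -(c / (a ^ 2 + b ^ 2)) • (a, b)) ⁻¹'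
      (LinearMap.ker L : Set (ℝ × ℝ)) := by
    ext p
    simp only [Set.mem_ofPred_eq, Set.mem_preimage, SetLike.mem_coe, LinearMap.mem_ker, hL,
      Prod.fst_add, Prod.snd_add, Prod.smul_fst, Prod.smul_snd, smul_eq_mul]
    have : a * (p.1 + -(c / (a ^ 2 + b ^ 2)) * a) + b * (p.2 + -(c / (a ^ 2 + b ^ 2)) * b)
        = a * p.1 + b * p.2 - c := by field_simp; ring
    rw [this, sub_eq_zero]
  rw [e, measure_preimage_add_right, hker]

theorem setIntegral_split_line {S : Set (ℝ × ℝ)} {f : ℝ × ℝ → ℂ} (hf : IntegrableOn f S)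
    (a b c : ℝ) (h : a ≠ 0 ∨ b ≠ 0) :
    ∫ p in S, f p = (∫ p in S ∩ {p | a * p.1 + b * p.2 < c}, f p)
      + ∫ p in S ∩ {p | c < a * p.1 + b * p.2}, f p := by
  have hm : MeasurableSet {p : ℝ × ℝ | a * p.1 + b * p.2 < c} :=
    (isOpen_lt (by fun_prop) (by fun_prop)).measurableSet
  rw [← integral_inter_add_sdiff hm hf]
  congr 1
  apply setIntegral_congr_set
  have hz := volume_line a b c h
  refine ae_eq_set.2 ⟨measure_mono_null (fun p hp => ?_) hz, ?_⟩
  · obtain ⟨⟨h1, h2⟩, h3⟩ := hp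
    exact le_antisymm (not_lt.1 fun h4 => h3 ⟨h1, h4⟩) (not_lt.1 h2)
  · have : (S ∩ {p : ℝ × ℝ | c < a * p.1 + b * p.2}) \ (S \ {p | a * p.1 + b * p.2 < c}) = ∅ := by
      ext p
      simp only [Set.mem_sdiff, Set.mem_inter_iff, Set.mem_ofPred_eq, Set.mem_empty_iff_false,
        iff_false]
      intro h
      exact h.2 ⟨h.1.1, not_lt.2 h.1.2.le⟩
    rw [this, measure_empty]

theorem measurePreserving_affine (a b c d e f : ℝ) (h : |a * d - b * c| = 1) :
    MeasurePreserving (fun p : ℝ × ℝ => (a * p.1 + b * p.2 + e, c * p.1 + d * p.2 + f)) ∧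
    MeasurableEmbedding (fun p : ℝ × ℝ => (a * p.1 + b * p.2 + e, c * p.1 + d * p.2 + f)) := by
  have hne : a * d - b * c ≠ 0 := by intro h0; rw [h0] at h; simp at h
  constructor
  · let L : ℝ × ℝ →ₗ[ℝ] ℝ × ℝ :=
      Matrix.toLin (.finTwoProd ℝ) (.finTwoProd ℝ) !![a, b; c, d]
    have hdet : LinearMap.det L = a * d - b * c := by
      simp [L, LinearMap.det_toLin, Matrix.det_fin_two_of]
    have hL : MeasurePreserving L := by
      refine ⟨L.toContinuousLinearMap.continuous.measurable, ?_⟩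
      rw [Measure.map_linearMap_addHaar_eq_smul_addHaar _ (by rw [hdet]; exact hne), hdet, abs_inv,
        h]
      simp
    have := (measurePreserving_add_right (volume : Measure (ℝ × ℝ)) (e, f)).comp hL
    convert! this using 1
    ext p <;> simp [L, Matrix.toLin_finTwoProd]
  · refine Continuous.measurableEmbedding (by fun_prop) ?_
    rintro ⟨x, y⟩ ⟨x', y'⟩ hxy
    simp only [Prod.mk.injEq] at hxy ⊢
    obtain ⟨h1, h2⟩ := hxy
    constructor <;> apply mul_left_cancel₀ hne
    · linear_combination d * h1 - b * h2
    · linear_combination a * h2 - c * h1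

/-- The open square of side `2π`. -/
def square : Set (ℝ × ℝ) := Set.Ioo 0 (2 * Real.pi) ×ˢ Set.Ioo 0 (2 * Real.pi)

theorem setIntegral_affine (a b c d e f : ℝ) (h : |a * d - b * c| = 1) (S S' : Set (ℝ × ℝ))
    (hS : ∀ p : ℝ × ℝ, (a * p.1 + b * p.2 + e, c * p.1 + d * p.2 + f) ∈ S ↔ p ∈ S')
    (g : ℝ × ℝ → ℂ) :
    ∫ p in S, g p = ∫ p in S', g (a * p.1 + b * p.2 + e, c * p.1 + d * p.2 + f) := by
  obtain ⟨h1, h2⟩ := measurePreserving_affine a b c d e f h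
  rw [← h1.setIntegral_preimage_emb h2]
  congr 2
  ext p
  exact hS p

theorem integrableOn_of_le_two_pi {f : ℝ × ℝ → ℂ} (hf : Continuous f) {S : Set (ℝ × ℝ)}
    (hS : ∀ p ∈ S, 0 ≤ p.1 ∧ 0 ≤ p.2 ∧ p.1 ≤ 2 * Real.pi ∧ p.2 ≤ 2 * Real.pi) :
    IntegrableOn f S := by
  refine (hf.continuousOn.integrableOn_compact (isCompact_Icc (a := ((0, 0) : ℝ × ℝ))
    (b := (2 * Real.pi, 2 * Real.pi)))).mono_set fun p hp => ?_
  obtain ⟨h1, h2, h3, h4⟩ := hS p hp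
  exact ⟨⟨h1, h2⟩, ⟨h3, h4⟩⟩

/-- The half of the open square above the diagonal. -/
def halfSquare : Set (ℝ × ℝ) := {p | 0 < p.1 ∧ p.1 < p.2 ∧ p.2 < 2 * Real.pi}

/-- The left quarter of the open square. -/
def quarterSquare : Set (ℝ × ℝ) := {p | 0 < p.1 ∧ p.1 < p.2 ∧ p.1 + p.2 < 2 * Real.pi}

/-- The square is cut along lines of measure zero, and each piece is carried back by a
measure-preserving affine map that descends to a torus automorphism. The factors are 2 here, 2 in
`setIntegral_halfSquare` and 3 in `setIntegral_quarterSquare`. -/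
theorem setIntegral_square {f : ℝ × ℝ → ℂ} (hf : Continuous f) :
    ∫ p in square, f p = ∫ p in halfSquare, (f p + f (p.2, p.1)) := by
  rw [setIntegral_split_line (S := square) (integrableOn_of_le_two_pi hf fun p hp =>
    ⟨hp.1.1.le, hp.2.1.le, hp.1.2.le, hp.2.2.le⟩) 1 (-1) 0 (by simp), integral_add]
  · congr 1
    · congr 2
      ext p
      simp only [square, halfSquare, Set.mem_inter_iff, Set.mem_prod, Set.mem_Ioo,
        Set.mem_ofPred_eq]
      grind
    · refine (setIntegral_affine 0 1 1 0 0 0 (by simp) _ halfSquare (fun p => ?_) f).trans ?_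
      · simp only [square, halfSquare, Set.mem_inter_iff, Set.mem_prod, Set.mem_Ioo,
          Set.mem_ofPred_eq]
        grind
      · simp
  all_goals
    refine integrableOn_of_le_two_pi (by fun_prop) fun p hp => ?_
    obtain ⟨h1, h2, h3⟩ := hp
    refine ⟨?_, ?_, ?_, ?_⟩ <;> linarith

theorem setIntegral_halfSquare {f : ℝ × ℝ → ℂ} (hf : Continuous f) :
    ∫ p in halfSquare, f p
      = ∫ p in quarterSquare, (f p + f (2 * Real.pi - p.2, 2 * Real.pi - p.1)) := by
  have hpi := Real.pi_pos
  rw [setIntegral_split_line (S := halfSquare) (integrableOn_of_le_two_pi hf fun p hp => by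
    obtain ⟨h1, h2, h3⟩ := hp
    refine ⟨?_, ?_, ?_, ?_⟩ <;> linarith) 1 1 (2 * Real.pi) (by simp), integral_add]
  · congr 1
    · congr 2
      ext p
      simp only [quarterSquare, halfSquare, Set.mem_inter_iff, Set.mem_ofPred_eq]
      grind
    · refine (setIntegral_affine 0 (-1) (-1) 0 (2 * Real.pi) (2 * Real.pi) (by simp) _
        quarterSquare (fun p => ?_) f).trans ?_
      · simp only [quarterSquare, halfSquare, Set.mem_inter_iff, Set.mem_ofPred_eq]
        grind
      · congr! 3
        ext <;> ring
  all_goals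
    refine integrableOn_of_le_two_pi (by fun_prop) fun p hp => ?_
    obtain ⟨h1, h2, h3⟩ := hp
    refine ⟨?_, ?_, ?_, ?_⟩ <;> linarith

theorem setIntegral_quarterSquare {f : ℝ × ℝ → ℂ} (hf : Continuous f) :
    ∫ p in quarterSquare, f p = ∫ p in triInt, (f p + f (p.1, 2 * Real.pi - p.1 - p.2)
        + f (p.2, 2 * Real.pi - p.1 - p.2)) := by
  have hpi := Real.pi_pos
  have hq : ∀ p ∈ quarterSquare, 0 ≤ p.1 ∧ 0 ≤ p.2 ∧ p.1 ≤ 2 * Real.pi ∧ p.2 ≤ 2 * Real.pi := by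
    rintro p ⟨h1, h2, h3⟩
    refine ⟨?_, ?_, ?_, ?_⟩ <;> linarith
  have ht : ∀ p ∈ triInt, 0 ≤ p.1 ∧ 0 ≤ p.2 ∧ p.1 ≤ 2 * Real.pi ∧ p.2 ≤ 2 * Real.pi := by
    rintro p ⟨h1, h2, h3⟩
    refine ⟨?_, ?_, ?_, ?_⟩ <;> linarith
  have hi : IntegrableOn f (quarterSquare ∩ {p | 2 * Real.pi < 1 * p.1 + 2 * p.2}) :=
    integrableOn_of_le_two_pi hf fun p hp => hq p hp.1
  rw [setIntegral_split_line (integrableOn_of_le_two_pi hf hq) 1 2 (2 * Real.pi) (by simp),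
    setIntegral_split_line hi 2 1 (2 * Real.pi) (by simp), integral_add, integral_add, add_assoc]
  · congr 1
    · congr 2
      ext p
      simp only [quarterSquare, triInt, Set.mem_inter_iff, Set.mem_ofPred_eq]
      grind
    congr 1
    · refine (setIntegral_affine 1 0 (-1) (-1) 0 (2 * Real.pi) (by simp) _
        triInt (fun p => ?_) f).trans ?_
      · simp only [quarterSquare, triInt, Set.mem_inter_iff, Set.mem_ofPred_eq]
        grind
      · congr! 3; ring_nf
    · refine (setIntegral_affine 0 1 (-1) (-1) 0 (2 * Real.pi) (by simp) _
        triInt (fun p => ?_) f).trans ?_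
      · simp only [quarterSquare, triInt, Set.mem_inter_iff, Set.mem_ofPred_eq]
        grind
      · congr! 3; ring_nf
  all_goals exact integrableOn_of_le_two_pi (by fun_prop) ht

/-- Unfolding the open square to twelve copies of the fundamental triangle. -/
theorem setIntegral_square_eq {f : ℝ × ℝ → ℂ} (hf : Continuous f) :
    ∫ p in square, f p = ∫ p in triInt,
      (f p + f (p.2, p.1) + (f (2 * Real.pi - p.2, 2 * Real.pi - p.1)
        + f (2 * Real.pi - p.1, 2 * Real.pi - p.2))
      + (f (p.1, 2 * Real.pi - p.1 - p.2) + f (2 * Real.pi - p.1 - p.2, p.1)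
        + (f (2 * Real.pi - (2 * Real.pi - p.1 - p.2), 2 * Real.pi - p.1)
        + f (2 * Real.pi - p.1, 2 * Real.pi - (2 * Real.pi - p.1 - p.2))))
      + (f (p.2, 2 * Real.pi - p.1 - p.2) + f (2 * Real.pi - p.1 - p.2, p.2)
        + (f (2 * Real.pi - (2 * Real.pi - p.1 - p.2), 2 * Real.pi - p.2)
        + f (2 * Real.pi - p.2, 2 * Real.pi - (2 * Real.pi - p.1 - p.2))))) := by
  rw [setIntegral_square hf, setIntegral_halfSquare (by fun_prop),
    setIntegral_quarterSquare (by fun_prop)]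

theorem cis_two_pi_sub (s : ℝ) : cis (2 * Real.pi - s) = (cis s)⁻¹ := by
  rw [cis, cis, ← Complex.exp_neg]
  push_cast
  rw [show (2 * (Real.pi : ℂ) - s) * Complex.I = 2 * Real.pi * Complex.I + -(s * Complex.I) by ring,
    Complex.exp_add, Complex.exp_two_pi_mul_I, one_mul]

theorem wt_swap (p q : ℤ) (z w : ℂ) : wt p q w z = wt q p z w := mul_comm _ _

theorem wt_inv (p q : ℤ) (z w : ℂ) : wt p q z⁻¹ w⁻¹ = wt (-p) (-q) z w := by
  simp [wt]

theorem wt_shear (p q : ℤ) {z w : ℂ} (hz : z ≠ 0) :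
    wt p q z (z⁻¹ * w⁻¹) = wt (p - q) (-q) z w := by
  simp only [wt, mul_zpow, zpow_sub₀ hz, zpow_neg, inv_zpow]
  ring

theorem orbSum_comp_swap {ε : ℂ} (hε : ε = 1 ∨ ε = -1) (δ : ℂ) (p q : ℤ) (z w : ℂ) :
    orbSum ε δ p q w z = ε * orbSum ε δ p q z w := by
  simp only [orbSum_eq, wt_swap _ _ z w]
  rcases hε with rfl | rfl <;> ring_nf

theorem orbSum_comp_inv {δ : ℂ} (hδ : δ = 1 ∨ δ = -1) (ε : ℂ) (p q : ℤ) (z w : ℂ) :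
    orbSum ε δ p q z⁻¹ w⁻¹ = δ * orbSum ε δ p q z w := by
  simp only [orbSum_eq, wt_inv _ _ z w]
  rcases hδ with rfl | rfl <;> ring_nf

theorem orbSum_comp_shear {ε : ℂ} (hε : ε = 1 ∨ ε = -1) (δ : ℂ) (p q : ℤ) {z w : ℂ} (hz : z ≠ 0) :
    orbSum ε δ p q z (z⁻¹ * w⁻¹) = ε * orbSum ε δ p q z w := by
  simp only [orbSum_eq, wt_shear _ _ hz]
  rcases hε with rfl | rfl <;> ring_nf

theorem continuous_wt_cis (p q : ℤ) : Continuous fun P : ℝ × ℝ => wt p q (cis P.1) (cis P.2) := by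
  have : (fun P : ℝ × ℝ => wt p q (cis P.1) (cis P.2))
      = fun P => Complex.exp ((p * P.1 + q * P.2 : ℝ) * Complex.I) := by
    ext P; rw [wt_cis, cis]
  rw [this]
  fun_prop

theorem continuous_orbSum_cis (ε δ : ℂ) (p q : ℤ) :
    Continuous fun P : ℝ × ℝ => orbSum ε δ p q (cis P.1) (cis P.2) := by
  simp only [orbSum]
  exact continuous_finsetSum _ fun i _ => continuous_const.mul (continuous_wt_cis _ _)

/-- The twelve arguments are the images of (z, w) under the group. At each image the orbit sum is
multiplied by the sign of the element, and the moved monomials with these signs add up to the other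
orbit sum. -/
theorem sum_wt_mul_orbSum {ε δ : ℂ} (hε : ε = 1 ∨ ε = -1) (hδ : δ = 1 ∨ δ = -1)
    (p q p' q' : ℤ) {z w : ℂ} (hz : z ≠ 0) (hw : w ≠ 0) (F : ℂ → ℂ → ℂ)
    (hF : ∀ z w, F z w = wt p q z w * orbSum ε δ p' q' z w) :
    F z w + F w z + (F w⁻¹ z⁻¹ + F z⁻¹ w⁻¹)
      + (F z (z⁻¹ * w⁻¹) + F (z⁻¹ * w⁻¹) z + (F (z⁻¹ * w⁻¹)⁻¹ z⁻¹ + F z⁻¹ (z⁻¹ * w⁻¹)⁻¹))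
      + (F w (z⁻¹ * w⁻¹) + F (z⁻¹ * w⁻¹) w + (F (z⁻¹ * w⁻¹)⁻¹ w⁻¹ + F w⁻¹ (z⁻¹ * w⁻¹)⁻¹))
      = orbSum ε δ p q z w * orbSum ε δ p' q' z w := by
  have a1 := orbSum_comp_shear hε δ p' q' (w := w) hz
  have a2 := orbSum_comp_shear hε δ p' q' (w := z) hw
  rw [mul_comm w⁻¹] at a2
  have b1 := fun p q => wt_shear p q (w := w) hz
  have b2 := fun p q => wt_shear p q (w := z) hw
  simp only [mul_comm w⁻¹] at b2
  simp only [hF, orbSum_comp_inv hδ, orbSum_comp_swap hε δ p' q' z (z⁻¹ * w⁻¹),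
    orbSum_comp_swap hε δ p' q' w (z⁻¹ * w⁻¹), a1, a2, orbSum_comp_swap hε δ p' q' z w, wt_inv,
    wt_swap _ _ z (z⁻¹ * w⁻¹), wt_swap _ _ w (z⁻¹ * w⁻¹), b1, b2, wt_swap _ _ z w]
  rw [orbSum_eq ε δ p q]
  rcases hε with rfl | rfl <;> ring_nf

theorem setIntegral_wt_mul_orbSum {ε δ : ℂ} (hε : ε = 1 ∨ ε = -1) (hδ : δ = 1 ∨ δ = -1)
    (p q p' q' : ℤ) :
    ∫ P in square, wt p q (cis P.1) (cis P.2) * orbSum ε δ p' q' (cis P.1) (cis P.2)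
      = ∫ P in triInt, orbSum ε δ p q (cis P.1) (cis P.2)
        * orbSum ε δ p' q' (cis P.1) (cis P.2) := by
  have hc : Continuous fun P : ℝ × ℝ =>
      wt p q (cis P.1) (cis P.2) * orbSum ε δ p' q' (cis P.1) (cis P.2) :=
    (continuous_wt_cis p q).mul (continuous_orbSum_cis ε δ p' q')
  rw [setIntegral_square_eq hc]
  congr 1
  funext P
  have e : 2 * Real.pi - P.1 - P.2 = 2 * Real.pi - (P.1 + P.2) := by ring
  have e2 : cis (2 * Real.pi - (P.1 + P.2)) = (cis P.1)⁻¹ * (cis P.2)⁻¹ := by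
    rw [cis_two_pi_sub, ← cis_mul, mul_inv]
  simp only [e, cis_two_pi_sub (2 * Real.pi - _), e2, cis_two_pi_sub P.1, cis_two_pi_sub P.2]
  exact sum_wt_mul_orbSum hε hδ p q p' q' (cis_ne_zero _) (cis_ne_zero _)
    (fun z w => wt p q z w * orbSum ε δ p' q' z w) fun _ _ => rfl

/-! ### Orthogonality of the orbit sums -/

theorem integral_cis (n : ℤ) : ∫ s in Set.Ioo 0 (2 * Real.pi), cis (n * s)
    = if n = 0 then (2 * Real.pi : ℂ) else 0 := by
  have hpi := Real.pi_pos
  rw [← integral_Ioc_eq_integral_Ioo, ← intervalIntegral.integral_of_le (by positivity)]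
  split_ifs with h
  · simp [h, cis]
  · have e : ∀ s : ℝ, cis (n * s) = Complex.exp ((n * Complex.I) * s) := by
      intro s; rw [cis]; push_cast; ring_nf
    have hn : (n : ℂ) * Complex.I ≠ 0 := by simp [h]
    simp only [e]
    rw [integral_exp_mul_complex hn]
    have : Complex.exp (n * Complex.I * ((2 * Real.pi : ℝ) : ℂ)) = 1 := by
      rw [← Complex.exp_int_mul_two_pi_mul_I n]; push_cast; ring_nf
    rw [this]
    simp

theorem integral_wt (p q : ℤ) : ∫ P in square, wt p q (cis P.1) (cis P.2)
    = if p = 0 ∧ q = 0 then (4 * Real.pi ^ 2 : ℂ) else 0 := by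
  have e : ∀ P : ℝ × ℝ, wt p q (cis P.1) (cis P.2) = cis (p * P.1) * cis (q * P.2) := by
    intro P; rw [wt_cis, cis_mul]
  simp only [e, square]
  rw [show (volume : Measure (ℝ × ℝ)) = volume.prod volume from rfl,
    setIntegral_prod_mul (fun s => cis (p * s)) (fun s => cis (q * s)), integral_cis, integral_cis]
  by_cases hp : p = 0 <;> by_cases hq : q = 0 <;> simp [hp, hq]
  ring

/-- After unfolding, only one monomial meets an orbit sum, and the integral picks out the terms with
opposite exponent. No conjugate is needed: negation lies in the group and costs only the sign δ. -/
theorem integral_orbSum_mul_orbSum {ε δ : ℂ} (hε : ε = 1 ∨ ε = -1) (hδ : δ = 1 ∨ δ = -1)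
    (p q p' q' : ℤ) :
    ∫ P in triInt, orbSum ε δ p q (cis P.1) (cis P.2) * orbSum ε δ p' q' (cis P.1) (cis P.2)
      = 4 * Real.pi ^ 2 * ∑ i, if orb p' q' i = (-p, -q) then chi ε δ i else 0 := by
  rw [← setIntegral_wt_mul_orbSum hε hδ]
  have e : ∀ P : ℝ × ℝ, wt p q (cis P.1) (cis P.2) * orbSum ε δ p' q' (cis P.1) (cis P.2)
      = ∑ i, chi ε δ i * wt (p + (orb p' q' i).1) (q + (orb p' q' i).2) (cis P.1) (cis P.2) := by
    intro P
    rw [orbSum, Finset.mul_sum]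
    refine Finset.sum_congr rfl fun i _ => ?_
    rw [wt_add (cis_ne_zero _) (cis_ne_zero _)]
    ring
  simp only [e]
  rw [integral_finsetSum, Finset.mul_sum]
  · refine Finset.sum_congr rfl fun i _ => ?_
    rw [integral_const_mul, integral_wt]
    have : (p + (orb p' q' i).1 = 0 ∧ q + (orb p' q' i).2 = 0) ↔ orb p' q' i = (-p, -q) := by
      rw [Prod.ext_iff]; simp only; omega
    simp only [this]
    split_ifs <;> ring
  · intro i _
    exact integrableOn_of_le_two_pi (continuous_const.mul (continuous_wt_cis _ _)) fun p hp =>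
      ⟨hp.1.1.le, hp.2.1.le, hp.1.2.le, hp.2.2.le⟩

theorem neg_one_pow_cases (n : ℕ) : (-1 : ℂ) ^ n = 1 ∨ (-1 : ℂ) ^ n = -1 :=
  neg_one_pow_eq_or ℂ n

/-- The negative of a dominant weight lies in its orbit, and an orbit contains only one dominant
weight. -/
theorem integral_altT_mul_altT_ne (r : ℕ × ℕ) {a b a' b' : ℕ} (h : (a, b) ≠ (a', b')) :
    ∫ P in triInt, altT r a b P * altT r a' b' P = 0 := by
  simp only [altT, alt]
  rw [integral_orbSum_mul_orbSum (neg_one_pow_cases _) (neg_one_pow_cases _), Finset.sum_eq_zero,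
    mul_zero]
  intro i _
  rw [if_neg]
  intro h'
  apply h
  rw [Prod.ext_iff] at h' ⊢
  fin_cases i <;> simp [orb] at h' ⊢ <;> omega

/-- Elements carrying the weight to its negative differ from negation by a stabilizer of the weight.
The stabilizer is generated by the simple reflections with vanishing coordinate, and these have sign
1 because r lies below the weight. So all contributing terms equal δ and cannot cancel. -/
theorem integral_altT_mul_self_ne_zero {r : ℕ × ℕ} (h1 : r.1 ≤ 1) (h2 : r.2 ≤ 1) {a b : ℕ}
    (ha : r.1 ≤ a) (hb : r.2 ≤ b) :
    ∫ P in triInt, altT r a b P * altT r a b P ≠ 0 := by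
  simp only [altT, alt]
  rw [integral_orbSum_mul_orbSum (neg_one_pow_cases _) (neg_one_pow_cases _)]
  have key : ∀ i, (if orb (a + b) (a + 2 * b) i = (-((a : ℤ) + b), -((a : ℤ) + 2 * b)) then
      chi ((-1) ^ r.2) ((-1) ^ (r.1 + r.2)) i else 0)
      = (-1) ^ (r.1 + r.2) *
        if orb (a + b) (a + 2 * b) i = (-((a : ℤ) + b), -((a : ℤ) + 2 * b)) then 1 else 0 := by
    intro i
    split_ifs with h
    · rw [mul_one]
      have hr1 : a = 0 → r.1 = 0 := by omega
      have hr2 : b = 0 → r.2 = 0 := by omega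
      rw [Prod.ext_iff] at h
      fin_cases i <;> simp [orb, chi] at h ⊢ <;> first
        | (rw [show r.1 = 0 by omega, show r.2 = 0 by omega]; simp)
        | (rw [show r.1 = 0 by omega]; simp)
        | (rw [show r.2 = 0 by omega]; simp)
    · simp
  simp only [key]
  rw [← Finset.mul_sum, Finset.sum_boole]
  have hc : (Finset.univ.filter fun i =>
      orb (a + b) (a + 2 * b) i = (-((a : ℤ) + b), -((a : ℤ) + 2 * b))).card ≠ 0 := by
    rw [Finset.card_ne_zero]
    -- Entry 6 of the orbit is the negative of the weight.
    exact ⟨6, by simp [orb]⟩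
  have hpi := Real.pi_ne_zero
  refine mul_ne_zero (by simp [hpi]) (mul_ne_zero (by simp) (by exact_mod_cast hc))

/-! ### Change of variables from △* to the triangle -/

/-- The Weyl denominator factors through the short and the long walls. The constants are 12, 4i, 4i,
and for r = (1, 1) the value (4i)²/4 = -4. -/
theorem altT_self {r : ℕ × ℕ} (h1 : r.1 ≤ 1) (h2 : r.2 ≤ 1) : ∃ κ : ℂ, κ ≠ 0 ∧ ∀ P,
    altT r r.1 r.2 P = κ * (sinOne P ^ r.1 * sinTwo P ^ r.2 : ℝ) := by
  have one : ∀ P, altT (1, 0) 1 0 P = 4 * Complex.I * sinOne P := by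
    intro P
    simp only [altT, alt, orbSum_eq, sinOne, wt_cis]
    norm_num
    have h : ∀ s t : ℝ, cis (-s + -t) = cis (-(s + t)) := by intros; ring_nf
    simp only [h, cis_eq, Real.cos_neg, Real.sin_neg]
    push_cast
    ring
  have two : ∀ P, altT (0, 1) 0 1 P = 4 * Complex.I * sinTwo P := by
    intro P
    simp only [altT, alt, orbSum_eq, sinTwo, wt_cis]
    norm_num
    have h : ∀ s t : ℝ, cis (-s + t) = cis (-(s - t)) := by intros; ring_nf
    have h' : ∀ s t : ℝ, cis (s + -t) = cis (s - t) := by intros; ring_nf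
    simp only [h, h', cis_eq, Real.cos_neg, Real.sin_neg]
    push_cast
    ring_nf
  have both : ∀ P, altT (1, 1) 1 1 P = altT (1, 0) 1 0 P * altT (0, 1) 0 1 P / 4 := by
    intro P
    have hz := cis_ne_zero P.1
    have hw := cis_ne_zero P.2
    simp only [altT, alt, orbSum_eq, wt_eq]
    norm_num [zpow_ofNat]
    generalize cis P.1 = z at *
    generalize cis P.2 = w at *
    field_simp
    ring
  obtain ⟨_ | _ | r1, _ | _ | r2⟩ := r
  · exact ⟨12, by norm_num, fun P => by simpa using altT_zero P⟩
  · exact ⟨4 * Complex.I, by simp, fun P => by simpa using two P⟩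
  · simp at h2
  · exact ⟨4 * Complex.I, by simp, fun P => by simpa using one P⟩
  · refine ⟨-4, by norm_num, fun P => ?_⟩
    simp only [zero_add, Nat.cast_one, both, one, two, pow_one]
    push_cast
    linear_combination (4 * sinOne P * sinTwo P : ℂ) * Complex.I_sq
  · simp at h2
  all_goals simp at h1

theorem isOpen_triInt : IsOpen triInt :=
  (isOpen_lt continuous_const continuous_fst).inter
    ((isOpen_lt continuous_fst continuous_snd).inter (isOpen_lt (continuous_fst.add (continuous_const.mul continuous_snd)) continuous_const))

theorem measurableSet_tri : MeasurableSet tri :=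
  ((isClosed_le continuous_const continuous_fst).inter ((isClosed_le continuous_fst
    continuous_snd).inter (isClosed_le (continuous_fst.add (continuous_const.mul continuous_snd)) continuous_const))).measurableSet

theorem tri_ae_eq : tri =ᵐ[volume] triInt := by
  refine ae_eq_set.2 ⟨?_, by rw [Set.sdiff_eq_empty.2 triInt_subset, measure_empty]⟩
  refine measure_mono_null (t := {p | 1 * p.1 + 0 * p.2 = 0} ∪ {p | 1 * p.1 + -1 * p.2 = 0} ∪
    {p | 1 * p.1 + 2 * p.2 = 2 * Real.pi}) ?_ ?_
  · rintro p ⟨⟨h1, h2, h3⟩, h⟩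
    simp only [triInt, Set.mem_ofPred_eq, Set.mem_union] at h ⊢
    grind
  · refine measure_union_null (measure_union_null ?_ ?_) ?_ <;>
    exact volume_line _ _ _ (by simp)

theorem setIntegral_deltaStar (g : ℝ × ℝ → ℝ) :
    ∫ p in deltaStar, g p = ∫ p in triInt, |(chartDeriv p).det| * g (chart p) := by
  rw [deltaStar_eq, integral_image_eq_integral_abs_det_fderiv_smul volume measurableSet_tri
    (fun p _ => (hasFDerivAt_chart p).hasFDerivWithinAt) injOn_chart,
    setIntegral_congr_set tri_ae_eq]
  rfl

theorem integrableOn_deltaStar_iff (g : ℝ × ℝ → ℝ) :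
    IntegrableOn g deltaStar ↔ IntegrableOn (fun p => |(chartDeriv p).det| * g (chart p)) triInt := by
  rw [deltaStar_eq, integrableOn_image_iff_integrableOn_abs_det_fderiv_smul volume
    measurableSet_tri (fun p _ => (hasFDerivAt_chart p).hasFDerivWithinAt) injOn_chart,
    integrableOn_congr_set_ae tri_ae_eq]
  rfl

theorem weight_eq (α β : ℝ) (p : ℝ × ℝ) : weight α β p =
    (4 * Real.pi ^ 2) ^ (α + β) / (3 : ℝ) ^ (2 * α + β) * facOne p ^ α * facTwo p ^ β := rfl

theorem sq_div_rpow_mul {c : ℝ} (hc : 0 < c) {s : ℝ} (hs : s ≠ 0) (n : ℕ) :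
    (s ^ 2 / c) ^ ((n : ℝ) - 1 / 2) * |s| = (s ^ n) ^ 2 / c ^ ((n : ℝ) - 1 / 2) := by
  have h2 : 0 < s ^ 2 := by positivity
  rw [Real.div_rpow h2.le hc.le, Real.rpow_sub h2, Real.rpow_natCast, ← Real.sqrt_eq_rpow,
    Real.sqrt_sq_eq_abs, ← pow_mul, mul_comm 2 n, pow_mul]
  field_simp

/-- A base s²/c to the power r - 1/2 times the factor |s| of the Jacobian is a multiple of s^(2r),
so the fractional powers disappear. -/
theorem exists_det_mul_weight (r : ℕ × ℕ) : ∃ K : ℝ, 0 < K ∧ ∀ p ∈ triInt,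
    |(chartDeriv p).det| * weight (r.1 - 1 / 2) (r.2 - 1 / 2) (chart p)
      = K * (sinOne p ^ r.1 * sinTwo p ^ r.2) ^ 2 := by
  have hpi := Real.pi_pos
  refine ⟨(4 * Real.pi ^ 2) ^ (((r.1 : ℝ) - 1 / 2) + (r.2 - 1 / 2)) /
    (3 : ℝ) ^ (2 * ((r.1 : ℝ) - 1 / 2) + (r.2 - 1 / 2))
    / (9 * 3 ^ ((r.1 : ℝ) - 1 / 2) * 9 ^ ((r.2 : ℝ) - 1 / 2)), by positivity, fun p hp => ?_⟩
  rw [weight_eq, det_chartDeriv, facOne_chart, facTwo_chart, abs_div, abs_mul]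
  have a := sq_div_rpow_mul (c := 3) (by norm_num) (sinOne_ne_zero hp) r.1
  have b := sq_div_rpow_mul (c := 9) (by norm_num) (sinTwo_ne_zero hp) r.2
  rw [show |(9 : ℝ)| = 9 by norm_num]
  set C := (4 * Real.pi ^ 2) ^ (((r.1 : ℝ) - 1 / 2) + (r.2 - 1 / 2)) /
    (3 : ℝ) ^ (2 * ((r.1 : ℝ) - 1 / 2) + (r.2 - 1 / 2))
  calc _ = C / 9 * ((sinOne p ^ 2 / 3) ^ ((r.1 : ℝ) - 1 / 2) * |sinOne p|)
        * ((sinTwo p ^ 2 / 9) ^ ((r.2 : ℝ) - 1 / 2) * |sinTwo p|) := by ring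
    _ = _ := by rw [a, b]; field_simp

theorem continuous_chart : Continuous chart :=
  continuous_iff_continuousAt.2 fun p => (hasFDerivAt_chart p).continuousAt

theorem continuous_evalAt (P : MvPolynomial (Fin 2) ℝ) : Continuous (evalAt P) := by
  refine (MvPolynomial.continuous_eval P).comp (continuous_pi fun i => ?_)
  fin_cases i
  · exact continuous_fst
  · exact continuous_snd

theorem continuous_evalAt_mul_altT (P : MvPolynomial (Fin 2) ℝ) (r : ℕ × ℕ) (a b : ℤ) :
    Continuous fun p => (evalAt P (chart p) : ℂ) * altT r a b p :=
  (Complex.continuous_ofReal.comp ((continuous_evalAt P).comp continuous_chart)).mul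
    (continuous_orbSum_cis _ _ _ _)

theorem triInt_bounds : ∀ p ∈ triInt, 0 ≤ p.1 ∧ 0 ≤ p.2 ∧ p.1 ≤ 2 * Real.pi ∧
    p.2 ≤ 2 * Real.pi := by
  rintro p ⟨h1, h2, h3⟩
  refine ⟨?_, ?_, ?_, ?_⟩ <;> linarith

/-- The pulled-back density is a constant times the square of the denominator. Each polynomial
absorbs one denominator, and the integrand is continuous, which also settles integrability. -/
theorem exists_integral_weight {r : ℕ × ℕ} (h1 : r.1 ≤ 1) (h2 : r.2 ≤ 1) :
    ∃ K : ℂ, K ≠ 0 ∧ ∀ P R : MvPolynomial (Fin 2) ℝ,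
      IntegrableOn (fun p => evalAt P p * evalAt R p * weight (r.1 - 1 / 2) (r.2 - 1 / 2) p)
        deltaStar ∧
      ((∫ p in deltaStar, evalAt P p * evalAt R p * weight (r.1 - 1 / 2) (r.2 - 1 / 2) p : ℝ) : ℂ)
        = K * ∫ p in triInt, (evalAt P (chart p) * altT r r.1 r.2 p)
          * (evalAt R (chart p) * altT r r.1 r.2 p) := by
  obtain ⟨K, hK, hw⟩ := exists_det_mul_weight r
  obtain ⟨κ, hκ, ha⟩ := altT_self h1 h2
  have key : ∀ P R : MvPolynomial (Fin 2) ℝ, ∀ p ∈ triInt,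
      ((|(chartDeriv p).det| * (evalAt P (chart p) * evalAt R (chart p)
        * weight (r.1 - 1 / 2) (r.2 - 1 / 2) (chart p)) : ℝ) : ℂ)
      = K / κ ^ 2 * ((evalAt P (chart p) * altT r r.1 r.2 p)
          * (evalAt R (chart p) * altT r r.1 r.2 p)) := by
    intro P R p hp
    rw [ha, mul_left_comm, hw p hp]
    push_cast
    field_simp
  refine ⟨K / κ ^ 2, by simp [hK.ne', hκ], fun P R => ?_⟩
  have hm := isOpen_triInt.measurableSet
  constructor
  · rw [integrableOn_deltaStar_iff]
    have : IntegrableOn (fun p => ((|(chartDeriv p).det| * (evalAt P (chart p) * evalAt R (chart p)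
        * weight (r.1 - 1 / 2) (r.2 - 1 / 2) (chart p)) : ℝ) : ℂ)) triInt := by
      refine IntegrableOn.congr_fun ?_ (fun p hp => (key P R p hp).symm) hm
      exact integrableOn_of_le_two_pi (continuous_const.mul ((continuous_evalAt_mul_altT P r _ _).mul
        (continuous_evalAt_mul_altT R r _ _))) triInt_bounds
    exact this.re
  · rw [setIntegral_deltaStar, ← integral_complex_ofReal, ← integral_const_mul]
    exact setIntegral_congr_fun hm (key P R)

/-! The divergence form of the operator in the interior of the region. -/

theorem facTwo_eq (p : ℝ × ℝ) :
    facTwo p = 3 * (2 * p.1 + 1) ^ 3 - (p.2 + 6 * p.1 + 2) ^ 2 := by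
  rw [facTwo]; ring

theorem facOne_nonneg {p : ℝ × ℝ} (hp : p ∈ deltaStar) : 0 ≤ facOne p := by
  rw [deltaStar_eq] at hp
  obtain ⟨q, -, rfl⟩ := hp
  rw [facOne_chart]; positivity

theorem facTwo_nonneg {p : ℝ × ℝ} (hp : p ∈ deltaStar) : 0 ≤ facTwo p := by
  rw [deltaStar_eq] at hp
  obtain ⟨q, -, rfl⟩ := hp
  rw [facTwo_chart]; positivity

theorem exists_vertical_nbhd {S : Set (ℝ × ℝ)} {p : ℝ × ℝ} (hp : p ∈ interior S) :
    ∃ ε > 0, (p.1, p.2 + ε) ∈ S ∧ (p.1, p.2 - ε) ∈ S := by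
  obtain ⟨ε, hε, h⟩ := Metric.isOpen_iff.1 isOpen_interior p hp
  refine ⟨ε / 2, by positivity, interior_subset (h ?_), interior_subset (h ?_)⟩ <;>
  · rw [Metric.mem_ball, Prod.dist_eq]
    simp [abs_of_pos hε, hε]

/-- The factor is a square on △*, hence nonnegative, and strictly increasing in y; a point slightly
below gives strict positivity. -/
theorem facOne_pos {p : ℝ × ℝ} (hp : p ∈ interior deltaStar) : 0 < facOne p := by
  obtain ⟨ε, hε, -, h⟩ := exists_vertical_nbhd hp
  have := facOne_nonneg h
  simp only [facOne] at *
  linarith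

/-- The factor is strictly concave in y and nonnegative slightly above and slightly below the point.
-/
theorem facTwo_pos {p : ℝ × ℝ} (hp : p ∈ interior deltaStar) : 0 < facTwo p := by
  obtain ⟨ε, hε, h1, h2⟩ := exists_vertical_nbhd hp
  have h1 := facTwo_nonneg h1
  have h2 := facTwo_nonneg h2
  rw [facTwo_eq] at *
  nlinarith [sq_nonneg ε, mul_pos hε hε]

open MvPolynomial in
theorem hasDerivAt_evalAt_fst (P : MvPolynomial (Fin 2) ℝ) (p : ℝ × ℝ) :
    HasDerivAt (fun s => evalAt P (s, p.2)) (evalAt (pderiv 0 P) p) p.1 := by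
  induction P using MvPolynomial.induction_on with
  | C a => simpa [evalAt] using hasDerivAt_const p.1 a
  | add P R hP hR =>
    refine ((hP.add hR).congr_of_eventuallyEq
      (.of_forall fun s => by simp [evalAt])).congr_deriv ?_
    simp [evalAt]
  | mul_X P i hP =>
    fin_cases i
    · refine ((hP.mul (hasDerivAt_id p.1)).congr_of_eventuallyEq
        (.of_forall fun s => by simp [evalAt])).congr_deriv ?_
      simp [evalAt, Derivation.leibniz]; ring
    · refine ((hP.mul_const p.2).congr_of_eventuallyEq
        (.of_forall fun s => by simp [evalAt])).congr_deriv ?_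
      simp [evalAt, Derivation.leibniz, pderiv_X]; ring

open MvPolynomial in
theorem hasDerivAt_evalAt_snd (P : MvPolynomial (Fin 2) ℝ) (p : ℝ × ℝ) :
    HasDerivAt (fun s => evalAt P (p.1, s)) (evalAt (pderiv 1 P) p) p.2 := by
  induction P using MvPolynomial.induction_on with
  | C a => simpa [evalAt] using hasDerivAt_const p.2 a
  | add P R hP hR =>
    refine ((hP.add hR).congr_of_eventuallyEq
      (.of_forall fun s => by simp [evalAt])).congr_deriv ?_
    simp [evalAt]
  | mul_X P i hP =>
    fin_cases i
    · refine ((hP.mul_const p.1).congr_of_eventuallyEq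
        (.of_forall fun s => by simp [evalAt])).congr_deriv ?_
      simp [evalAt, Derivation.leibniz, pderiv_X]; ring
    · refine ((hP.mul (hasDerivAt_id p.2)).congr_of_eventuallyEq
        (.of_forall fun s => by simp [evalAt])).congr_deriv ?_
      simp [evalAt, Derivation.leibniz]; ring

open MvPolynomial in
theorem partialX_evalAt (P : MvPolynomial (Fin 2) ℝ) (p : ℝ × ℝ) :
    partialX (evalAt P) p = evalAt (pderiv 0 P) p := (hasDerivAt_evalAt_fst P p).deriv

open MvPolynomial in
theorem partialY_evalAt (P : MvPolynomial (Fin 2) ℝ) (p : ℝ × ℝ) :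
    partialY (evalAt P) p = evalAt (pderiv 1 P) p := (hasDerivAt_evalAt_snd P p).deriv

theorem hasDerivAt_mul_rpow {f g : ℝ → ℝ} {f' g' x : ℝ} (hf : HasDerivAt f f' x)
    (hg : HasDerivAt g g' x) (α β C : ℝ) (hf0 : 0 < f x) (hg0 : 0 < g x) :
    HasDerivAt (fun s => C * f s ^ α * g s ^ β)
      (C * f x ^ α * g x ^ β * (α * f' / f x + β * g' / g x)) x := by
  refine (((hf.rpow_const (Or.inl hf0.ne')).const_mul C).mul
    (hg.rpow_const (Or.inl hg0.ne'))).congr_deriv ?_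
  rw [Real.rpow_sub_one hf0.ne', Real.rpow_sub_one hg0.ne']
  field_simp

theorem hasDerivAt_weight_fst (α β : ℝ) {p : ℝ × ℝ} (h1 : 0 < facOne p) (h2 : 0 < facTwo p) :
    HasDerivAt (fun s => weight α β (s, p.2)) (weight α β p *
      (α * (-6 * p.1) / facOne p + β * (72 * p.1 ^ 2 - 12 * p.2 - 6) / facTwo p)) p.1 := by
  have a : HasDerivAt (fun s => facOne (s, p.2)) (-6 * p.1) p.1 := by
    simp only [facOne]
    refine (((hasDerivAt_pow 2 p.1).const_mul 3).const_sub (1 + 2 * p.2)).congr_deriv ?_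
    norm_num; ring
  have b : HasDerivAt (fun s => facTwo (s, p.2)) (72 * p.1 ^ 2 - 12 * p.2 - 6) p.1 := by
    have h := hasDerivAt_id' p.1
    simp only [facTwo]
    refine ((((((h.pow 3).const_mul 24).sub_const (p.2 ^ 2)).sub
      ((h.const_mul 12).mul_const p.2)).sub (h.const_mul 6)).sub_const (4 * p.2)
        |>.sub_const 1).congr_deriv ?_
    norm_num; ring
  exact hasDerivAt_mul_rpow a b α β _ h1 h2

theorem hasDerivAt_weight_snd (α β : ℝ) {p : ℝ × ℝ} (h1 : 0 < facOne p) (h2 : 0 < facTwo p) :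
    HasDerivAt (fun s => weight α β (p.1, s)) (weight α β p *
      (α * 2 / facOne p + β * (-2 * p.2 - 12 * p.1 - 4) / facTwo p)) p.2 := by
  have h := hasDerivAt_id' p.2
  have a : HasDerivAt (fun s => facOne (p.1, s)) 2 p.2 := by
    simp only [facOne]
    refine (((h.const_mul 2).const_add 1).sub_const (3 * p.1 ^ 2)).congr_deriv ?_
    norm_num
  have b : HasDerivAt (fun s => facTwo (p.1, s)) (-2 * p.2 - 12 * p.1 - 4) p.2 := by
    simp only [facTwo]
    refine ((((((h.pow 2).const_sub (24 * p.1 ^ 3)).sub (h.const_mul (12 * p.1))).sub_const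
      (6 * p.1)).sub (h.const_mul 4)).sub_const 1).congr_deriv ?_
    norm_num
  exact hasDerivAt_mul_rpow a b α β _ h1 h2

theorem weight_neg_mul_weight (α β : ℝ) {p : ℝ × ℝ} (h1 : 0 < facOne p) (h2 : 0 < facTwo p) :
    weight (-α) (-β) p * weight α β p = 1 := by
  have hpi := Real.pi_pos
  rw [weight_eq, weight_eq, show -α + -β = -(α + β) by ring,
    show 2 * -α + -β = -(2 * α + β) by ring, Real.rpow_neg h1.le, Real.rpow_neg h2.le,
    Real.rpow_neg (by positivity), Real.rpow_neg (by norm_num)]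
  have a1 := Real.rpow_pos_of_pos h1 α
  have a2 := Real.rpow_pos_of_pos h2 β
  have a3 := Real.rpow_pos_of_pos (show 0 < 4 * Real.pi ^ 2 by positivity) (α + β)
  have a4 := Real.rpow_pos_of_pos (show (0 : ℝ) < 3 by norm_num) (2 * α + β)
  field_simp

open MvPolynomial in
theorem pderiv_ofNat (i : Fin 2) (n : ℕ) [n.AtLeastTwo] :
    pderiv i (ofNat(n) : MvPolynomial (Fin 2) ℝ) = 0 :=
  (pderiv i).map_natCast n

-- The product rule with the logarithmic derivative of the weight; since w_{-α,-β} w_{α,β} = 1 in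
-- the interior, only that logarithmic derivative survives.
open MvPolynomial in
theorem opDiv_eq (α β : ℝ) (P : MvPolynomial (Fin 2) ℝ) {p : ℝ × ℝ} (h1 : 0 < facOne p)
    (h2 : 0 < facTwo p) : opDiv α β (evalAt P) p = evalAt (opL α β P) p := by
  have add : ∀ P R p, evalAt (P + R) p = evalAt P p + evalAt R p := fun P R p => map_add _ _ _
  have mul : ∀ P R p, evalAt (P * R) p = evalAt P p * evalAt R p := fun P R p => map_mul _ _ _
  have dX := (hasDerivAt_weight_fst α β h1 h2).mul (hasDerivAt_evalAt_fst
    (A₁₁ * pderiv 0 P + A₁₂ * pderiv 1 P) p)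
  have dY := (hasDerivAt_weight_snd α β h1 h2).mul (hasDerivAt_evalAt_snd
    (A₁₂ * pderiv 0 P + A₂₂ * pderiv 1 P) p)
  have hD : opDiv α β (evalAt P) p = -weight (-α) (-β) p *
      (deriv ((fun s => weight α β (s, p.2)) *
        fun s => evalAt (A₁₁ * pderiv 0 P + A₁₂ * pderiv 1 P) (s, p.2)) p.1
      + deriv ((fun s => weight α β (p.1, s)) *
        fun s => evalAt (A₁₂ * pderiv 0 P + A₂₂ * pderiv 1 P) (p.1, s)) p.2) := by
    simp only [opDiv, partialX_evalAt, partialY_evalAt, ← mul, ← add]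
    rfl
  have hw := weight_neg_mul_weight α β h1 h2
  have a11 : evalAt A₁₁ p = -6 * p.1 ^ 2 + p.2 + 3 * p.1 + 2 := by simp [evalAt, A₁₁]
  have a12 : evalAt A₁₂ p = -9 * p.1 * p.2 + 18 * p.1 ^ 2 - 6 * p.2 - 3 := by simp [evalAt, A₁₂]
  have a22 : evalAt A₂₂ p = -18 * p.2 ^ 2 + 108 * p.1 ^ 3 - 54 * p.1 * p.2 - 27 * p.1 - 9 * p.2 := by
    simp [evalAt, A₂₂]
  have d11 : evalAt (pderiv 0 A₁₁) p = -12 * p.1 + 3 := by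
    simp [evalAt, A₁₁, Derivation.leibniz, pderiv_X, pderiv_ofNat]; ring
  have d12 : evalAt (pderiv 0 A₁₂) p = -9 * p.2 + 36 * p.1 := by
    simp [evalAt, A₁₂, Derivation.leibniz, pderiv_X, pderiv_ofNat]; ring
  have d12' : evalAt (pderiv 1 A₁₂) p = -9 * p.1 - 6 := by
    simp [evalAt, A₁₂, Derivation.leibniz, pderiv_X, pderiv_ofNat]
  have d22 : evalAt (pderiv 1 A₂₂) p = -36 * p.2 - 54 * p.1 - 9 := by
    simp [evalAt, A₂₂, Derivation.leibniz, pderiv_X, pderiv_ofNat]; ring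
  have hL : evalAt (opL α β P) p = -evalAt A₁₁ p * evalAt (pderiv 0 (pderiv 0 P)) p
      - 2 * evalAt A₁₂ p * evalAt (pderiv 0 (pderiv 1 P)) p
      - evalAt A₂₂ p * evalAt (pderiv 1 (pderiv 1 P)) p
      + ((21 + 12 * α + 18 * β) * p.1 + (6 * α + 3)) * evalAt (pderiv 0 P) p
      + ((18 + 36 * α) * p.1 + (45 + 36 * β + 18 * α) * p.2 + (18 * β + 9))
        * evalAt (pderiv 1 P) p := by
    simp [evalAt, opL]
  rw [hD, dX.deriv, dY.deriv, hL]
  simp only [map_add, Derivation.leibniz, smul_eq_mul, add, mul, pderiv_pderiv_comm, d11, d12, d12',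
    d22, a11, a12, a22]
  generalize evalAt (pderiv 0 (pderiv 0 P)) p = u00
  generalize evalAt (pderiv 0 (pderiv 1 P)) p = u01
  generalize evalAt (pderiv 1 (pderiv 1 P)) p = u11
  generalize evalAt (pderiv 0 P) p = u0
  generalize evalAt (pderiv 1 P) p = u1
  have k1 := h1.ne'
  have k2 := h2.ne'
  -- Λ applied to the gradient of each weight factor is a polynomial multiple of that factor, which
  -- cancels the denominators; `g2` treats the second factor.
  have g1 : (α * (-6 * p.1) / facOne p) * ((-6 * p.1 ^ 2 + p.2 + 3 * p.1 + 2) * u0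
      + (-9 * p.1 * p.2 + 18 * p.1 ^ 2 - 6 * p.2 - 3) * u1)
      + (α * 2 / facOne p) * ((-9 * p.1 * p.2 + 18 * p.1 ^ 2 - 6 * p.2 - 3) * u0
      + (-18 * p.2 ^ 2 + 108 * p.1 ^ 3 - 54 * p.1 * p.2 - 27 * p.1 - 9 * p.2) * u1)
      = -α * ((12 * p.1 + 6) * u0 + (36 * p.1 + 18 * p.2) * u1) := by
    field_simp
    rw [facOne]
    ring
  have g2 : (β * (72 * p.1 ^ 2 - 12 * p.2 - 6) / facTwo p) *
      ((-6 * p.1 ^ 2 + p.2 + 3 * p.1 + 2) * u0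
      + (-9 * p.1 * p.2 + 18 * p.1 ^ 2 - 6 * p.2 - 3) * u1)
      + (β * (-2 * p.2 - 12 * p.1 - 4) / facTwo p) *
      ((-9 * p.1 * p.2 + 18 * p.1 ^ 2 - 6 * p.2 - 3) * u0
      + (-18 * p.2 ^ 2 + 108 * p.1 ^ 3 - 54 * p.1 * p.2 - 27 * p.1 - 9 * p.2) * u1)
      = -β * (18 * p.1 * u0 + (36 * p.2 + 18) * u1) := by
    field_simp
    rw [facTwo]
    ring
  generalize α * (-6 * p.1) / facOne p = s1 at *
  generalize α * 2 / facOne p = s2 at *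
  generalize β * (72 * p.1 ^ 2 - 12 * p.2 - 6) / facTwo p = s3 at *
  generalize β * (-2 * p.2 - 12 * p.1 - 4) / facTwo p = s4 at *
  have hp : ((p.1, p.2) : ℝ × ℝ) = p := rfl
  simp only [hp]
  generalize weight (-α) (-β) p = W' at *
  generalize weight α β p = W at *
  linear_combination (-(s1 + s3) * ((-6 * p.1 ^ 2 + p.2 + 3 * p.1 + 2) * u0
      + (-9 * p.1 * p.2 + 18 * p.1 ^ 2 - 6 * p.2 - 3) * u1)
      - (s2 + s4) * ((-9 * p.1 * p.2 + 18 * p.1 ^ 2 - 6 * p.2 - 3) * u0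
      + (-18 * p.2 ^ 2 + 108 * p.1 ^ 3 - 54 * p.1 * p.2 - 27 * p.1 - 9 * p.2) * u1)
      - ((-6 * p.1 ^ 2 + p.2 + 3 * p.1 + 2) * u00 + (-12 * p.1 + 3) * u0
      + (-9 * p.1 * p.2 + 18 * p.1 ^ 2 - 6 * p.2 - 3) * u01 + (-9 * p.2 + 36 * p.1) * u1
      + (-9 * p.1 * p.2 + 18 * p.1 ^ 2 - 6 * p.2 - 3) * u01 + (-9 * p.1 - 6) * u0
      + (-18 * p.2 ^ 2 + 108 * p.1 ^ 3 - 54 * p.1 * p.2 - 27 * p.1 - 9 * p.2) * u11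
      + (-36 * p.2 - 54 * p.1 - 9) * u1)) * hw - g1 - g2

/-! ### The pulled-back form, triangular bases and uniqueness -/

/-- The complexified inner product with `R`, pulled back to the fundamental triangle. -/
def formB (r : ℕ × ℕ) (R : MvPolynomial (Fin 2) ℝ) : MvPolynomial (Fin 2) ℝ →ₗ[ℝ] ℂ where
  toFun P := ∫ p in triInt, (evalAt P (chart p) * altT r r.1 r.2 p)
    * (evalAt R (chart p) * altT r r.1 r.2 p)
  map_add' P P' := by
    rw [← integral_add]
    · congr 1
      ext p
      rw [show evalAt (P + P') (chart p) = evalAt P (chart p) + evalAt P' (chart p) from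
        map_add _ _ _]
      push_cast
      ring
    all_goals exact integrableOn_of_le_two_pi ((continuous_evalAt_mul_altT _ r _ _).mul
        (continuous_evalAt_mul_altT R r _ _)) triInt_bounds
  map_smul' c P := by
    rw [RingHom.id_apply, ← integral_smul]
    congr 1
    ext p
    rw [show evalAt (c • P) (chart p) = c * evalAt P (chart p) by simp [evalAt],
      Complex.real_smul]
    push_cast
    ring

theorem formB_apply (r : ℕ × ℕ) (R P : MvPolynomial (Fin 2) ℝ) :
    formB r R P = ∫ p in triInt, (evalAt P (chart p) * altT r r.1 r.2 p)
    * (evalAt R (chart p) * altT r r.1 r.2 p) := rfl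

theorem IsRep.evalAt_mul {r k : ℕ × ℕ} {Q : MvPolynomial (Fin 2) ℝ} (h : IsRep r k Q) (p : ℝ × ℝ) :
    (evalAt Q (chart p) : ℂ) * altT r r.1 r.2 p = altT r (k.1 + r.1) (k.2 + r.2) p := by
  rw [← pev_cis]
  exact h _ _ (cis_ne_zero _) (cis_ne_zero _)

theorem formB_rep_ne {r k j : ℕ × ℕ} {Q R : MvPolynomial (Fin 2) ℝ} (hQ : IsRep r k Q)
    (hR : IsRep r j R) (h : k ≠ j) : formB r R Q = 0 := by
  rw [formB_apply]
  simp only [hQ.evalAt_mul, hR.evalAt_mul]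
  refine mod_cast integral_altT_mul_altT_ne r (a := k.1 + r.1) (b := k.2 + r.2) (a' := j.1 + r.1)
    (b' := j.2 + r.2) fun h' => h ?_
  rw [Prod.ext_iff] at h' ⊢
  simp only at h'
  omega

theorem formB_rep_self {r k : ℕ × ℕ} (h1 : r.1 ≤ 1) (h2 : r.2 ≤ 1) {Q : MvPolynomial (Fin 2) ℝ}
    (hQ : IsRep r k Q) : formB r Q Q ≠ 0 := by
  rw [formB_apply]
  simp only [hQ.evalAt_mul]
  exact mod_cast integral_altT_mul_self_ne_zero h1 h2 (a := k.1 + r.1) (b := k.2 + r.2)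
    (by omega) (by omega)

/-- The total mass is, up to a nonzero constant, the form at the polynomial 1, which represents the
index (0, 0). -/
theorem normConst_ne_zero {r : ℕ × ℕ} (h1 : r.1 ≤ 1) (h2 : r.2 ≤ 1) :
    normConst (r.1 - 1 / 2) (r.2 - 1 / 2) ≠ 0 := by
  obtain ⟨K, hK, h⟩ := exists_integral_weight h1 h2
  have hr : IsRep r (0, 0) 1 := fun z w _ _ => by simp [pev]
  have h11 := (h 1 1).2
  rw [← formB_apply] at h11
  have : ((∫ p in deltaStar, weight (r.1 - 1 / 2) (r.2 - 1 / 2) p : ℝ) : ℂ) ≠ 0 := by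
    have e : ∀ p, evalAt 1 p = 1 := fun p => map_one _
    simp only [e, one_mul] at h11
    rw [h11]
    exact mul_ne_zero hK (formB_rep_self h1 h2 hr)
  rw [normConst]
  exact one_div_ne_zero (by exact_mod_cast this)

theorem innerW_eq_zero_iff {r : ℕ × ℕ} (h1 : r.1 ≤ 1) (h2 : r.2 ≤ 1)
    (P R : MvPolynomial (Fin 2) ℝ) :
    innerW (r.1 - 1 / 2) (r.2 - 1 / 2) P R = 0 ↔ formB r R P = 0 := by
  obtain ⟨K, hK, h⟩ := exists_integral_weight h1 h2
  have h11 := (h P R).2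
  rw [← formB_apply] at h11
  rw [innerW, mul_eq_zero, or_iff_right (normConst_ne_zero h1 h2), ← Complex.ofReal_eq_zero, h11,
    mul_eq_zero, or_iff_right hK]

theorem coeff_mono (j k : ℕ × ℕ) :
    (mono j).coeff (Finsupp.single 0 k.1 + Finsupp.single 1 k.2) = if j = k then 1 else 0 := by
  have : mono j = MvPolynomial.monomial (Finsupp.single 0 j.1 + Finsupp.single 1 j.2) (1 : ℝ) := by
    rw [mono, MvPolynomial.X_pow_eq_monomial, MvPolynomial.X_pow_eq_monomial,
      MvPolynomial.monomial_mul, one_mul]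
  rw [this, MvPolynomial.coeff_monomial]
  congr 1
  rw [eq_iff_iff]
  constructor
  · intro h
    have a := DFunLike.congr_fun h 0
    have b := DFunLike.congr_fun h 1
    simp at a b
    exact Prod.ext a b
  · rintro rfl; rfl

theorem starLT_irrefl (k : ℕ × ℕ) : ¬StarLT k k := by
  unfold StarLT; omega

theorem coeff_of_mem_PiLT {k : ℕ × ℕ} {P : MvPolynomial (Fin 2) ℝ} (h : P ∈ PiLT k) :
    P.coeff (Finsupp.single 0 k.1 + Finsupp.single 1 k.2) = 0 := by
  have : PiLT k ≤ LinearMap.ker (MvPolynomial.lcoeff ℝ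
      (Finsupp.single (0 : Fin 2) k.1 + Finsupp.single 1 k.2)) := by
    refine Submodule.span_le.2 ?_
    rintro _ ⟨j, hj, rfl⟩
    have hne : j ≠ k := by rintro rfl; exact starLT_irrefl _ hj
    simp only [SetLike.mem_coe, LinearMap.mem_ker, MvPolynomial.lcoeff_apply, coeff_mono,
      if_neg hne]
  exact this h

theorem PiLT_le_PiStarPair (k : ℕ × ℕ) : PiLT k ≤ PiStarPair k :=
  Submodule.span_mono fun _ ⟨j, hj, e⟩ => ⟨j, Or.inl hj, e⟩

theorem PiStarPair_le_PiStar (k : ℕ × ℕ) : PiStarPair k ≤ PiStar (mDeg k) :=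
  Submodule.span_mono fun _ ⟨j, hj, e⟩ => ⟨j, by
    rcases hj with hj | rfl
    · unfold StarLT mDeg at *; omega
    · exact le_rfl, e⟩

theorem sub_coeff_smul_mono_mem {k : ℕ × ℕ} {P : MvPolynomial (Fin 2) ℝ} (h : P ∈ PiStarPair k) :
    P - P.coeff (Finsupp.single 0 k.1 + Finsupp.single 1 k.2) • mono k ∈ PiLT k := by
  induction h using Submodule.span_induction with
  | mem P h =>
    obtain ⟨j, hj, rfl⟩ := h
    rw [show MvPolynomial.X 0 ^ j.1 * MvPolynomial.X 1 ^ j.2 = mono j from rfl, coeff_mono]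
    rcases hj with hj | rfl
    · have hne : j ≠ k := by rintro rfl; exact starLT_irrefl _ hj
      rw [if_neg hne, zero_smul, sub_zero]
      exact mono_mem_PiLT hj
    · simp
  | zero => simp
  | add P R _ _ hP hR =>
    rw [MvPolynomial.coeff_add, add_smul, add_sub_add_comm]
    exact add_mem hP hR
  | smul c P _ hP =>
    rw [MvPolynomial.coeff_smul, smul_assoc, ← smul_sub]
    exact Submodule.smul_mem _ _ hP

theorem HasLead.mem_PiStarPair {k : ℕ × ℕ} {Q : MvPolynomial (Fin 2) ℝ} (h : HasLead k Q) :
    Q ∈ PiStarPair k := by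
  obtain ⟨c, -, hc⟩ := h
  rw [← sub_add_cancel Q (c • mono k)]
  exact add_mem (PiLT_le_PiStarPair k hc)
    (Submodule.smul_mem _ _ (Submodule.subset_span ⟨k, Or.inr rfl, rfl⟩))

theorem HasLead.coeff_ne_zero {k : ℕ × ℕ} {Q : MvPolynomial (Fin 2) ℝ} (h : HasLead k Q) :
    Q.coeff (Finsupp.single 0 k.1 + Finsupp.single 1 k.2) ≠ 0 := by
  obtain ⟨c, hc, hQ⟩ := h
  have := coeff_of_mem_PiLT hQ
  rw [MvPolynomial.coeff_sub, MvPolynomial.coeff_smul, coeff_mono, if_pos rfl, smul_eq_mul,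
    mul_one, sub_eq_zero] at this
  rwa [this]

/-- Triangular inversion along the well-founded *-order. -/
theorem mono_mem_span {Q : ℕ × ℕ → MvPolynomial (Fin 2) ℝ} (hl : ∀ k, HasLead k (Q k)) (k : ℕ × ℕ) :
    mono k ∈ Submodule.span ℝ (Q '' {j | StarLT j k ∨ j = k}) := by
  induction k using wellFounded_starLT.induction with
  | _ k ih =>
    obtain ⟨c, hc, h⟩ := hl k
    have hlow : PiLT k ≤ Submodule.span ℝ (Q '' {j | StarLT j k ∨ j = k}) := by
      refine Submodule.span_le.2 ?_
      rintro _ ⟨j, hj, rfl⟩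
      refine Submodule.span_mono (Set.image_mono fun i hi => ?_) (ih j hj)
      rcases hi with hi | rfl
      · exact Or.inl (starLT_trans hi hj)
      · exact Or.inl hj
    have e : mono k = c⁻¹ • (Q k - (Q k - c • mono k)) := by
      rw [sub_sub_cancel, smul_smul, inv_mul_cancel₀ hc, one_smul]
    rw [e]
    exact Submodule.smul_mem _ _ (sub_mem (Submodule.subset_span ⟨k, Or.inr rfl, rfl⟩) (hlow h))

theorem PiLT_le_span {Q : ℕ × ℕ → MvPolynomial (Fin 2) ℝ} (hl : ∀ k, HasLead k (Q k))
    (k : ℕ × ℕ) : PiLT k ≤ Submodule.span ℝ (Q '' {j | StarLT j k}) := by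
  refine Submodule.span_le.2 ?_
  rintro _ ⟨j, hj, rfl⟩
  refine Submodule.span_mono (Set.image_mono fun i hi => ?_) (mono_mem_span hl j)
  rcases hi with hi | rfl
  · exact starLT_trans hi hj
  · exact hj

theorem span_range_eq_top {Q : ℕ × ℕ → MvPolynomial (Fin 2) ℝ} (hl : ∀ k, HasLead k (Q k)) :
    Submodule.span ℝ (Set.range Q) = ⊤ := by
  refine eq_top_iff.2 fun P _ => ?_
  induction P using MvPolynomial.induction_on' with
  | monomial m c =>
    have e : MvPolynomial.monomial m c = c • mono (m 0, m 1) := by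
      rw [mono, MvPolynomial.monomial_eq, MvPolynomial.smul_eq_C_mul,
        Finsupp.prod_fintype _ _ fun _ => pow_zero _]
      simp
    rw [e]
    exact Submodule.smul_mem _ _
      (Submodule.span_mono (Set.image_subset_range _ _) (mono_mem_span hl _))
  | add P R hP hR => exact add_mem (hP trivial) (hR trivial)

theorem formB_comm (r : ℕ × ℕ) (P R : MvPolynomial (Fin 2) ℝ) : formB r R P = formB r P R := by
  simp only [formB_apply, mul_comm]

theorem formB_eq_zero_of_mem_span {r : ℕ × ℕ} {Q : ℕ × ℕ → MvPolynomial (Fin 2) ℝ}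
    (hr : ∀ k, IsRep r k (Q k)) {s : Set (ℕ × ℕ)} {j : ℕ × ℕ} (hj : j ∉ s)
    {P : MvPolynomial (Fin 2) ℝ} (hP : P ∈ Submodule.span ℝ (Q '' s)) : formB r (Q j) P = 0 := by
  have : Submodule.span ℝ (Q '' s) ≤ LinearMap.ker (formB r (Q j)) := by
    refine Submodule.span_le.2 ?_
    rintro _ ⟨i, hi, rfl⟩
    exact formB_rep_ne (hr i) (hr j) fun e => hj (e ▸ hi)
  exact this hP

/-- The representatives span all polynomials and the form is diagonal on them with nonzero entries,
so pairing with each one isolates a coefficient. -/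
theorem eq_zero_of_formB {r : ℕ × ℕ} (h1 : r.1 ≤ 1) (h2 : r.2 ≤ 1)
    {Q : ℕ × ℕ → MvPolynomial (Fin 2) ℝ} (hl : ∀ k, HasLead k (Q k)) (hr : ∀ k, IsRep r k (Q k))
    {P : MvPolynomial (Fin 2) ℝ} (h : ∀ j, formB r (Q j) P = 0) : P = 0 := by
  have hP : P ∈ Submodule.span ℝ (Set.range Q) := by rw [span_range_eq_top hl]; trivial
  obtain ⟨c, rfl⟩ := Finsupp.mem_span_range_iff_exists_finsupp.1 hP
  suffices c = 0 by rw [this, Finsupp.sum_zero_index]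
  ext j
  have hj := h j
  rw [Finsupp.sum, map_sum, Finset.sum_eq_single j] at hj
  · rw [map_smul, smul_eq_zero] at hj
    exact hj.resolve_right (formB_rep_self h1 h2 (hr j))
  · intro i _ hi
    rw [map_smul, formB_rep_ne (hr i) (hr j) hi, smul_zero]
  · intro hj
    rw [Finsupp.notMem_support_iff.1 hj, zero_smul, map_zero]

/-- The form sees only the values of P times the denominator on the open triangle. Nondegeneracy
thus turns a pointwise identity there into an identity of polynomials. -/
theorem eq_of_evalAt_mul_altT {r : ℕ × ℕ} (h1 : r.1 ≤ 1) (h2 : r.2 ≤ 1)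
    {P R : MvPolynomial (Fin 2) ℝ} (h : ∀ p ∈ triInt,
      (evalAt P (chart p) : ℂ) * altT r r.1 r.2 p = evalAt R (chart p) * altT r r.1 r.2 p) :
    P = R := by
  choose Q hl hr using exists_rep h1 h2
  rw [← sub_eq_zero]
  refine eq_zero_of_formB h1 h2 hl hr fun j => ?_
  rw [map_sub, sub_eq_zero, formB_apply, formB_apply]
  refine setIntegral_congr_fun isOpen_triInt.measurableSet fun p hp => ?_
  simp only [h p hp]

theorem IsRep.opL_eq {r k : ℕ × ℕ} (h1 : r.1 ≤ 1) (h2 : r.2 ≤ 1) {Q : MvPolynomial (Fin 2) ℝ}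
    (hQ : IsRep r k Q) : opL (r.1 - 1 / 2) (r.2 - 1 / 2) Q
      = MvPolynomial.C (eigval (r.1 - 1 / 2) (r.2 - 1 / 2) k) * Q := by
  refine eq_of_evalAt_mul_altT h1 h2 fun p _ => ?_
  have := pev_opL_mul_alt h1 h2 hQ (cis_ne_zero p.1) (cis_ne_zero p.2)
  rw [pev_cis, pev_cis] at this
  rw [altT, this]
  simp only [evalAt, map_mul, MvPolynomial.eval_C]
  push_cast
  ring

theorem altT_self_ne_zero {r : ℕ × ℕ} (h1 : r.1 ≤ 1) (h2 : r.2 ≤ 1) {p : ℝ × ℝ}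
    (hp : p ∈ triInt) : altT r r.1 r.2 p ≠ 0 := by
  obtain ⟨κ, hκ, h⟩ := altT_self h1 h2
  rw [h]
  refine mul_ne_zero hκ (Complex.ofReal_ne_zero.2 (mul_ne_zero ?_ ?_))
  · exact pow_ne_zero _ (sinOne_ne_zero hp)
  · exact pow_ne_zero _ (sinTwo_ne_zero hp)

theorem opL_smul (α β c : ℝ) (P : MvPolynomial (Fin 2) ℝ) : opL α β (c • P) = c • opL α β P := by
  simp only [opL, MvPolynomial.smul_eq_C_mul, MvPolynomial.pderiv_C_mul]
  ring

/-! ### Chebyshev polynomials and the Jacobi system -/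

theorem IsRep.isChebyshev {r k : ℕ × ℕ} (h1 : r.1 ≤ 1) (h2 : r.2 ≤ 1)
    {Q : MvPolynomial (Fin 2) ℝ} (hQ : IsRep r k Q) :
    IsChebyshev (r.1 - 1 / 2) (r.2 - 1 / 2) k.1 k.2 Q :=
  (isChebyshev_iff h1 h2 k Q).2 fun p _ _ => hQ.evalAt_mul p

theorem isChebyshev_unique {r k : ℕ × ℕ} (h1 : r.1 ≤ 1) (h2 : r.2 ≤ 1)
    {Q Q' : MvPolynomial (Fin 2) ℝ} (hQ : IsChebyshev (r.1 - 1 / 2) (r.2 - 1 / 2) k.1 k.2 Q)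
    (hQ' : IsChebyshev (r.1 - 1 / 2) (r.2 - 1 / 2) k.1 k.2 Q') : Q' = Q := by
  rw [isChebyshev_iff h1 h2] at hQ hQ'
  refine eq_of_evalAt_mul_altT h1 h2 fun p hp => ?_
  have hp' := altT_self_ne_zero h1 h2 hp
  rw [hQ p (triInt_subset hp) hp', hQ' p (triInt_subset hp) hp']

/-- The multiple of `P` in which the coefficient of the monomial with exponent `k` is `1`. -/
def monic (k : ℕ × ℕ) (P : MvPolynomial (Fin 2) ℝ) : MvPolynomial (Fin 2) ℝ :=
  (P.coeff (Finsupp.single 0 k.1 + Finsupp.single 1 k.2))⁻¹ • P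

theorem isJacobiSystem_monic {r : ℕ × ℕ} (h1 : r.1 ≤ 1) (h2 : r.2 ≤ 1)
    {Q : ℕ × ℕ → MvPolynomial (Fin 2) ℝ} (hl : ∀ k, HasLead k (Q k))
    (hr : ∀ k, IsRep r k (Q k)) :
    IsJacobiSystem (r.1 - 1 / 2) (r.2 - 1 / 2) fun k => monic k (Q k) where
  mem k := Submodule.smul_mem _ _ (hl k).mem_PiStarPair
  leading k := by
    rw [monic, MvPolynomial.coeff_smul, smul_eq_mul, inv_mul_cancel₀ (hl k).coeff_ne_zero]
  eigen k := by
    rw [monic, opL_smul, (hr k).opL_eq h1 h2, mul_smul_comm]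
  integrable k j := by
    obtain ⟨K, -, h⟩ := exists_integral_weight h1 h2
    exact (h _ _).1
  orthogonal k j h := by
    rw [innerW_eq_zero_iff h1 h2, monic, monic, map_smul, formB_comm, map_smul,
      formB_rep_ne (hr j) (hr k) h.symm, smul_zero, smul_zero]

/-- Gram–Schmidt uniqueness: the difference of two candidates at k has only lower terms, and by
induction it is orthogonal to every lower member of the system, hence to all lower polynomials. -/
theorem isJacobiSystem_unique {r : ℕ × ℕ} (h1 : r.1 ≤ 1) (h2 : r.2 ≤ 1)
    {J J' : ℕ × ℕ → MvPolynomial (Fin 2) ℝ}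
    (hJ : IsJacobiSystem (r.1 - 1 / 2) (r.2 - 1 / 2) J)
    (hJ' : IsJacobiSystem (r.1 - 1 / 2) (r.2 - 1 / 2) J') : J' = J := by
  choose Q hl hr using exists_rep h1 h2
  have low : ∀ {J}, IsJacobiSystem (r.1 - 1 / 2) (r.2 - 1 / 2) J → ∀ k, J k - mono k ∈ PiLT k := by
    intro J hJ k
    have := sub_coeff_smul_mono_mem (hJ.mem k)
    rwa [hJ.leading k, one_smul] at this
  have lead : ∀ k, HasLead k (J k) := fun k => ⟨1, one_ne_zero, by
    rw [one_smul]; exact low hJ k⟩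
  have orth : ∀ {J}, IsJacobiSystem (r.1 - 1 / 2) (r.2 - 1 / 2) J → ∀ k j, k ≠ j →
      formB r (J j) (J k) = 0 := fun hJ k j h =>
    (innerW_eq_zero_iff h1 h2 _ _).1 (hJ.orthogonal k j h)
  funext k
  induction k using wellFounded_starLT.induction with
  | _ k ih =>
    have hD : J' k - J k ∈ PiLT k := by
      have := sub_mem (low hJ' k) (low hJ k)
      rwa [sub_sub_sub_cancel_right] at this
    rw [← sub_eq_zero]
    refine eq_zero_of_formB h1 h2 hl hr fun j => ?_
    -- For j below k the representative lies in the span of the lower members of the system; for the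
    -- other j the difference expands in representatives of index different from j.
    by_cases hj : StarLT j k
    · have hQ := PiLT_le_span lead k ((hl j).mem_PiLT hj)
      have : Submodule.span ℝ (J '' {i | StarLT i k}) ≤
          LinearMap.ker (formB r (J' k - J k)) := by
        refine Submodule.span_le.2 ?_
        rintro _ ⟨i, hi, rfl⟩
        have hik : k ≠ i := by rintro rfl; exact starLT_irrefl _ hi
        rw [SetLike.mem_coe, LinearMap.mem_ker, formB_comm, map_sub, orth hJ k i hik, ← ih i hi,
          orth hJ' k i hik, sub_zero]
      rw [formB_comm]
      exact this hQ
    · exact formB_eq_zero_of_mem_span hr hj (PiLT_le_span hl k hD)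

theorem exists_jacobi_chebyshev {r : ℕ × ℕ} (h1 : r.1 ≤ 1) (h2 : r.2 ≤ 1) (α β : ℝ)
    (hα : α = r.1 - 1 / 2) (hβ : β = r.2 - 1 / 2) :
    ∃ J : ℕ × ℕ → MvPolynomial (Fin 2) ℝ,
      IsJacobiSystem α β J ∧
      (∀ J' : ℕ × ℕ → MvPolynomial (Fin 2) ℝ, IsJacobiSystem α β J' → J' = J) ∧
      ∀ k₁ k₂ : ℕ, ∃ Q : MvPolynomial (Fin 2) ℝ,
        IsChebyshev α β k₁ k₂ Q ∧
        (∀ Q' : MvPolynomial (Fin 2) ℝ, IsChebyshev α β k₁ k₂ Q' → Q' = Q) ∧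
        opL α β Q = MvPolynomial.C (eigval α β (k₁, k₂)) * Q ∧
        (∀ p ∈ interior deltaStar,
          opDiv α β (evalAt Q) p = eigval α β (k₁, k₂) * evalAt Q p) ∧
        Q ∈ PiStar (mDeg (k₁, k₂)) ∧
        ∃ c : ℝ, c ≠ 0 ∧ Q = MvPolynomial.C c * J (k₁, k₂) := by
  choose Q hl hr using exists_rep h1 h2
  subst hα hβ
  refine ⟨_, isJacobiSystem_monic h1 h2 hl hr, fun J' hJ' =>
    isJacobiSystem_unique h1 h2 (isJacobiSystem_monic h1 h2 hl hr) hJ', fun k₁ k₂ =>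
    ⟨Q (k₁, k₂), (hr (k₁, k₂)).isChebyshev h1 h2, fun Q' hQ' =>
      isChebyshev_unique h1 h2 ((hr (k₁, k₂)).isChebyshev h1 h2) hQ', (hr _).opL_eq h1 h2,
      fun p hp => ?_, PiStarPair_le_PiStar _ (hl _).mem_PiStarPair,
      _, (hl (k₁, k₂)).coeff_ne_zero, ?_⟩⟩
  · rw [opDiv_eq _ _ _ (facOne_pos hp) (facTwo_pos hp), (hr _).opL_eq h1 h2]
    simp [evalAt]
  · rw [monic, ← MvPolynomial.smul_eq_C_mul, smul_smul,
      mul_inv_cancel₀ (hl (k₁, k₂)).coeff_ne_zero, one_smul]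

end

end G2Cheb

theorem corollary5p7 (α β : ℝ) (hα : α = 1 / 2 ∨ α = -1 / 2) (hβ : β = 1 / 2 ∨ β = -1 / 2) :
    ∃ J : ℕ × ℕ → MvPolynomial (Fin 2) ℝ,
      G2Cheb.IsJacobiSystem α β J ∧
      (∀ J' : ℕ × ℕ → MvPolynomial (Fin 2) ℝ, G2Cheb.IsJacobiSystem α β J' → J' = J) ∧
      ∀ k₁ k₂ : ℕ, ∃ Q : MvPolynomial (Fin 2) ℝ,
        G2Cheb.IsChebyshev α β k₁ k₂ Q ∧
        (∀ Q' : MvPolynomial (Fin 2) ℝ, G2Cheb.IsChebyshev α β k₁ k₂ Q' → Q' = Q) ∧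
        G2Cheb.opL α β Q = MvPolynomial.C (G2Cheb.eigval α β (k₁, k₂)) * Q ∧
        (∀ p ∈ interior G2Cheb.deltaStar,
          G2Cheb.opDiv α β (G2Cheb.evalAt Q) p
            = G2Cheb.eigval α β (k₁, k₂) * G2Cheb.evalAt Q p) ∧
        Q ∈ G2Cheb.PiStar (G2Cheb.mDeg (k₁, k₂)) ∧
        ∃ c : ℝ, c ≠ 0 ∧ Q = MvPolynomial.C c * J (k₁, k₂) := by
  -- The integer n is γ + 1/2, an entry of r.
  have key : ∀ γ : ℝ, γ = 1 / 2 ∨ γ = -1 / 2 → ∃ n : ℕ, n ≤ 1 ∧ γ = n - 1 / 2 := by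
    rintro γ (rfl | rfl)
    · exact ⟨1, le_rfl, by norm_num⟩
    · exact ⟨0, zero_le_one, by norm_num⟩
  obtain ⟨m, hm, hα⟩ := key α hα
  obtain ⟨n, hn, hβ⟩ := key β hβ
  exact G2Cheb.exists_jacobi_chebyshev (r := (m, n)) hm hn α β hα hβ
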